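/- Let $n\ge 2$, let $U\in C^\infty([0,\infty),\mathbb R)$ with $U\ge 0$, and let $f\in C_0^\infty(B_1(0))$ be a real-valued smooth function with compact support in the open unit ball of $\mathbb R^n$. For $z\in\mathbb S^{n-1}$ and $\psi\in[0,\pi/2]$ let $$S(z,\psi)=\{z+r\omega : r\ge 0,\ \omega\in\mathbb S^{n-1},\ -\langle\omega,z\rangle=\cos\psi\},\qquad (\mathcal Cf)(z,\psi)=\int_{S(z,\psi)} f(x)\,U(\|x-z\|)\,dS(x),$$ where $dS$ is the $(n-1)$-dimensional surface measure (the normalized $(n-1)$-dimensional Hausdorff measure). Let $(Y_{\ell,k})$, $\ell\in\mathbb N_0$, $1\le k\le N(n,\ell)$, be a complete orthonormal system of $L^2(\mathbb S^{n-1})$ of real spherical harmonics, $Y_{\ell,k}$ being of degree $\ell$ and $N(n,\ell)$ being the dimension of the space of spherical harmonics of degree $\ell$, and let $$f_{\ell,k}(\rho)=\int_{\mathbb S^{n-1}} f(\rho\theta)\,Y_{\ell,k}(\theta)\,dS(\theta),\qquad (\mathcal Cf)_{\ell,k}(\psi)=\int_{\mathbb S^{n-1}}(\mathcal Cf)(z,\psi)\,Y_{\ell,k}(z)\,dS(z)$$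 be the coefficients of $f$ and $\mathcal Cf$ with respect to this system. Let $C_\ell^{\mu}$ denote the Gegenbauer polynomial of degree $\ell$ normalized by $C_\ell^{\mu}(1)=1$ (for $\mu=0$, the Chebyshev polynomial of the first kind). Then for all $(\ell,k)$ and all $\psi\in[0,\pi/2]$ (with $\psi\neq 0$ if $n=2$), the integral defining $(\mathcal Cf)(z,\psi)$ exists for every $z$, the function $(\mathcal Cf)(\cdot,\psi)$ belongs to $L^2(\mathbb S^{n-1})$, the integral below converges absolutely, and $$(\mathcal Cf)_{\ell,k}(\psi)=|\mathbb S^{n-2}|\int_{\sin\psi}^{1} f_{\ell,k}(\rho)\,\frac{\rho\,K_\ell(\psi,\rho)}{\sqrt{\rho^2-\sin^2\psi}}\,d\rho,$$ where $|\mathbb S^{n-2}|$ is the surface area of the unit sphere of $\mathbb R^{n-1}$ ($|\mathbb S^0|=2$) and $$K_\ell(\psi,\rho)=(\sin\psi)^{n-2}\sum_{\sigma=\pm1}U\!\left(\cos\psi-\sigma\sqrt{\rho^2-\sin^2\psi}\right)\left(\cos\psi-\sigma\sqrt{\rho^2-\sin^2\psi}\right)^{n-2} C_\ell^{(n-2)/2}\!\left(\frac{\sin^2\psi+\sigma\cos\psi\sqrt{\rho^2-\sin^2\psi}}{\rho}\right).$$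 -/

import Mathlib

open MeasureTheory Metric Set
open scoped ContDiff RealInnerProductSpace

noncomputable section

namespace ConicalRadon

/-- Euclidean space `ℝⁿ`. -/
abbrev Euc (n : ℕ) : Type := EuclideanSpace ℝ (Fin n)

/-- The unit sphere `S^{n-1}` of `ℝⁿ`. -/
abbrev Sph (n : ℕ) : Type := sphere (0 : Euc n) 1

/-- The (unnormalized) surface measure of the unit sphere of `ℝⁿ`. -/
abbrev sphMeasure (n : ℕ) : Measure (Sph n) := (volume : Measure (Euc n)).toSphere

/-- The total surface area of the unit sphere of `ℝᵐ`. For `m = 1` this is the number `2` of points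
of the zero-dimensional sphere. -/
def sphArea (m : ℕ) : ℝ := (sphMeasure m).real univ

/-! ### Test functions, cones, and the weighted conical Radon transform -/

/-- `f` is a real smooth function on `ℝⁿ` with compact support in the open unit ball. -/
structure IsTestFunction {n : ℕ} (f : Euc n → ℝ) : Prop where
  contDiff : ContDiff ℝ ∞ f
  hasCompactSupport : HasCompactSupport f
  tsupport_subset : tsupport f ⊆ ball 0 1

/-- `U` is a nonnegative smooth function on `[0, ∞)`; its values on `(-∞, 0)` play no role. -/
structure IsRadialWeight (U : ℝ → ℝ) : Prop where
  contDiffOn : ContDiffOn ℝ ∞ U (Ici 0)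
  nonneg : ∀ r, 0 ≤ r → 0 ≤ U r

/-- The surface of the circular half cone with vertex `z`, central axis `-z` and half-opening
angle `ψ`. -/
def cone {n : ℕ} (z : Sph n) (ψ : ℝ) : Set (Euc n) :=
  {x | ∃ r : ℝ, ∃ η : Sph n, 0 ≤ r ∧ -⟪(η : Euc n), (z : Euc n)⟫ = Real.cos ψ ∧
    x = (z : Euc n) + r • (η : Euc n)}

/-- The standard surface measure on the cone: `(n-1)`-dimensional Hausdorff measure, normalized so
as to agree with Lebesgue measure on `(n-1)`-dimensional Euclidean spaces. -/
def coneMeasure {n : ℕ} (z : Sph n) (ψ : ℝ) : Measure (Euc n) :=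
  (Measure.euclideanHausdorffMeasure (n - 1)).restrict (cone z ψ)

/-- The weighted conical Radon transform. -/
def conicalRadon {n : ℕ} (U : ℝ → ℝ) (f : Euc n → ℝ) (z : Sph n) (ψ : ℝ) : ℝ :=
  ∫ x, f x * U ‖x - (z : Euc n)‖ ∂(coneMeasure z ψ)

/-! ### Spherical harmonics -/

/-- The Laplacian on real polynomials in `n` variables. -/
def polyLaplacian (n : ℕ) : MvPolynomial (Fin n) ℝ →ₗ[ℝ] MvPolynomial (Fin n) ℝ :=
  ∑ i, (MvPolynomial.pderiv i).toLinearMap ∘ₗ (MvPolynomial.pderiv i).toLinearMap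

/-- Restriction of a polynomial in `n` variables to the unit sphere of `ℝⁿ`. -/
def restrictSph (n : ℕ) : MvPolynomial (Fin n) ℝ →ₗ[ℝ] C(Sph n, ℝ) where
  toFun P := ⟨fun θ => MvPolynomial.eval (fun i => (θ : Euc n) i) P, by
    refine (MvPolynomial.continuous_eval P).comp ?_
    fun_prop⟩
  map_add' P Q := by ext θ; simp
  map_smul' c P := by ext θ; simp

/-- The space of spherical harmonics of degree `ℓ`: restrictions to the unit sphere of harmonic
polynomials that are homogeneous of degree `ℓ`. -/
def sphericalHarmonics (n ℓ : ℕ) : Submodule ℝ C(Sph n, ℝ) :=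
  (MvPolynomial.homogeneousSubmodule (Fin n) ℝ ℓ ⊓ LinearMap.ker (polyLaplacian n)).map
    (restrictSph n)

/-- The dimension `N(n, ℓ)` of the space of spherical harmonics of degree `ℓ`. -/
def numHarmonics (n ℓ : ℕ) : ℕ := Module.finrank ℝ (sphericalHarmonics n ℓ)

/-- The set `I(n)` of all pairs `(ℓ, k)` with `ℓ ∈ ℕ` and `k` one of `N(n, ℓ)` indices. -/
abbrev HarmonicIndex (n : ℕ) : Type := Σ ℓ : ℕ, Fin (numHarmonics n ℓ)

/-- `(Y_{ℓ,k})` is a complete orthonormal system of `L²(S^{n-1})` that consists of spherical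
harmonics, `Y_{ℓ,k}` being of degree `ℓ`. -/
structure IsHarmonicSystem {n : ℕ} (Y : HarmonicIndex n → C(Sph n, ℝ)) : Prop where
  mem : ∀ i : HarmonicIndex n, Y i ∈ sphericalHarmonics n i.1
  orthonormal : Orthonormal ℝ fun i => ContinuousMap.toLp 2 (sphMeasure n) ℝ (Y i)
  complete : (Submodule.span ℝ
    (range fun i => ContinuousMap.toLp 2 (sphMeasure n) ℝ (Y i))).topologicalClosure = ⊤

/-- The coefficient of a function `h` on the sphere with respect to `Y`. -/
def sphCoeff {n : ℕ} (Y : C(Sph n, ℝ)) (h : Sph n → ℝ) : ℝ :=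
  ∫ θ, h θ * Y θ ∂(sphMeasure n)

/-- The coefficients are those of the expansion with respect to the system `Y`. -/
theorem IsHarmonicSystem.hasSum_sphCoeff {n : ℕ} {Y : HarmonicIndex n → C(Sph n, ℝ)}
    (hY : IsHarmonicSystem Y) {h : Sph n → ℝ} (hh : MemLp h 2 (sphMeasure n)) :
    HasSum (fun i => sphCoeff (Y i) h • ContinuousMap.toLp 2 (sphMeasure n) ℝ (Y i))
      (hh.toLp h) := by
  have := (HilbertBasis.mk hY.orthonormal hY.complete.ge).hasSum_repr (hh.toLp h)
  convert this using 2 with i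
  rw [HilbertBasis.repr_apply_apply, HilbertBasis.coe_mk, L2.inner_def]
  congr 1
  refine integral_congr_ae ?_
  filter_upwards [hh.coeFn_toLp, ContinuousMap.coeFn_toLp (𝕜 := ℝ) (p := 2) (sphMeasure n) (Y i)]
    with θ h1 h2
  rw [h1, h2]
  simp

/-- `f_{ℓ,k}(r)`, where `Y = Y_{ℓ,k}`: the coefficient of `θ ↦ f(rθ)`. -/
def radialCoeff {n : ℕ} (Y : C(Sph n, ℝ)) (f : Euc n → ℝ) (r : ℝ) : ℝ :=
  sphCoeff Y fun θ => f (r • (θ : Euc n))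

/-- `(𝒞f)_{ℓ,k}(ψ)`, where `Y = Y_{ℓ,k}`: the coefficient of `z ↦ (𝒞f)(z, ψ)`. -/
def conicalCoeff {n : ℕ} (Y : C(Sph n, ℝ)) (U : ℝ → ℝ) (f : Euc n → ℝ) (ψ : ℝ) : ℝ :=
  sphCoeff Y fun z => conicalRadon U f z ψ

/-! ### Gegenbauer polynomials and the kernel -/

/-- The Gegenbauer polynomial of degree `ℓ` and order `μ ≥ 0`, normalized so that its value at `1`
is `1`, by its three-term recurrence
`(ℓ + 2μ + 1) C_{ℓ+2} = 2 (ℓ + 1 + μ) x C_{ℓ+1} - (ℓ + 1) C_ℓ`.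
For `μ = 0` these are the Chebyshev polynomials of the first kind. -/
def gegenbauer (μ : ℝ) : ℕ → Polynomial ℝ
  | 0 => 1
  | 1 => Polynomial.X
  | ℓ + 2 => Polynomial.C ((ℓ + 2 * μ + 1)⁻¹) *
      (Polynomial.C (2 * (ℓ + 1 + μ)) * Polynomial.X * gegenbauer μ (ℓ + 1) -
        Polynomial.C (ℓ + 1 : ℝ) * gegenbauer μ ℓ)

/-- The normalization of the Gegenbauer polynomials. -/
theorem gegenbauer_eval_one {μ : ℝ} (hμ : 0 ≤ μ) (ℓ : ℕ) : (gegenbauer μ ℓ).eval 1 = 1 := by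
  induction ℓ using Nat.twoStepInduction with
  | zero => simp [gegenbauer]
  | one => simp [gegenbauer]
  | more ℓ h0 h1 =>
    have : (ℓ : ℝ) + 2 * μ + 1 ≠ 0 := by positivity
    simp only [gegenbauer, Polynomial.eval_mul, Polynomial.eval_sub, Polynomial.eval_C,
      Polynomial.eval_X, h0, h1]
    field_simp
    ring

/-- The summand of the kernel that belongs to the sign `σ`. -/
def kernelTerm (n : ℕ) (U : ℝ → ℝ) (ℓ : ℕ) (ψ ρ σ : ℝ) : ℝ :=
  U (Real.cos ψ - σ * √(ρ ^ 2 - Real.sin ψ ^ 2)) *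
    (Real.cos ψ - σ * √(ρ ^ 2 - Real.sin ψ ^ 2)) ^ (n - 2) *
    (gegenbauer (((n : ℝ) - 2) / 2) ℓ).eval
      ((Real.sin ψ ^ 2 + σ * Real.cos ψ * √(ρ ^ 2 - Real.sin ψ ^ 2)) / ρ)

/-- The kernel `K_ℓ(ψ, ρ)`. -/
def kernel (n : ℕ) (U : ℝ → ℝ) (ℓ : ℕ) (ψ ρ : ℝ) : ℝ :=
  Real.sin ψ ^ (n - 2) * (kernelTerm n U ℓ ψ ρ 1 + kernelTerm n U ℓ ψ ρ (-1))

end ConicalRadon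

end

/-!
The idea is to turn the coefficient of `𝒞f` into an average over the orthogonal group, where the
mean value property of spherical harmonics applies.

*Graph coordinates.* Over the hyperplane orthogonal to `z`, the cone with vertex `z` is the graph
`y ↦ (1 - cot ψ * ‖y‖) z + y`, whose Jacobian is the constant `1 / sin ψ`. By the area formula, the
Hausdorff measure on the cone is `1 / sin ψ` times the image of Lebesgue measure
(`coneMeasure_eq_map`). The area formula for a constant Jacobian
(`euclideanHausdorffMeasure_image_of_normDet_eq`) holds because on small pieces the map is, up to a
factor close to `1`, isometric to its derivative. Transporting the coordinates at one fixed vertex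
`p` by a rotation `g` gives `𝒞f (g p)` as an integral of `f (g x)` over a fixed cone
(`conicalRadon_rotate`).

*Mean value property.* An integral over the sphere is an average over the rotations `g` of a point,
so that after Fubini the coefficient involves, for each point `x = ρ θ` of the fixed cone, the mean
over `g` of `f (ρ g θ) * Y (g p)`. The mean over `g` of `f (ρ g θ) * Y (g w)` is, in the variable
`w`, a spherical harmonic of degree `ℓ` that is invariant under the rotations about `θ`. Such a zonal
harmonic is determined by its value at `θ`: it is that value times `C_ℓ ⟪w, θ⟫`
(`eval_eq_gegenbauer_of_zonal`), since harmonicity is a two-term recurrence for the coefficients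
of the monomials `x₀ ^ (ℓ - 2 * j) * (x₁ ^ 2 + ⋯) ^ j`, and the solutions of that recurrence satisfy
the three-term recurrence of the Gegenbauer polynomials in `ℓ`. Its value at `θ` is the coefficient
of `f` at radius `ρ`, divided by the area of the sphere (`integral_orthMeasure_mul_eq`).

*Abel integral.* What remains depends on `‖y‖` only. Polar coordinates reduce it to an integral over
the distance `r` from the vertex, and the substitution `ρ ^ 2 = (r - cos ψ) ^ 2 + sin ψ ^ 2`, which
folds the half line at `r = cos ψ`, produces the two terms of the kernel and the Abel-type weight
(`integral_Ioi_eq_abel`).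
-/

noncomputable section

namespace ConicalRadon

/-! ### Rotations of spherical harmonics -/

/-- The linear form `x ↦ ⟪v, x⟫` as a polynomial. -/
def linForm {n : ℕ} (v : Euc n) : MvPolynomial (Fin n) ℝ :=
  ∑ i, MvPolynomial.C (v i) * MvPolynomial.X i

theorem eval_linForm {n : ℕ} (v x : Euc n) :
    MvPolynomial.eval (fun i => x i) (linForm v) = ⟪v, x⟫ := by
  simp [linForm, PiLp.inner_apply, mul_comm]

theorem pderiv_linForm {n : ℕ} (v : Euc n) (i : Fin n) :
    MvPolynomial.pderiv i (linForm v) = MvPolynomial.C (v i) := by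
  classical
  simp [linForm, MvPolynomial.pderiv_X, Pi.single_apply]

theorem isHomogeneous_linForm {n : ℕ} (v : Euc n) : (linForm v).IsHomogeneous 1 := by
  refine MvPolynomial.IsHomogeneous.sum _ _ _ fun i _ => ?_
  simpa using (MvPolynomial.isHomogeneous_C (Fin n) (v i)).mul (MvPolynomial.isHomogeneous_X ℝ i)

/-- The chain rule for the substitution of linear forms. -/
theorem pderiv_bind₁_linForm {n : ℕ} (u : Fin n → Euc n) (i : Fin n)
    (P : MvPolynomial (Fin n) ℝ) :
    MvPolynomial.pderiv i (MvPolynomial.bind₁ (fun j => linForm (u j)) P) =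
      ∑ j, MvPolynomial.C (u j i) *
        MvPolynomial.bind₁ (fun j => linForm (u j)) (MvPolynomial.pderiv j P) := by
  classical
  induction P using MvPolynomial.induction_on with
  | C a => simp
  | add p q hp hq => simp [hp, hq, mul_add, Finset.sum_add_distrib]
  | mul_X p k hp =>
    have hX : ∀ j, MvPolynomial.pderiv j (MvPolynomial.X k : MvPolynomial (Fin n) ℝ) =
        if j = k then 1 else 0 := by
      intro j
      rw [MvPolynomial.pderiv_X, Pi.single_apply]
      simp [eq_comm]
    rw [map_mul, MvPolynomial.bind₁_X_right, MvPolynomial.pderiv_mul, hp, pderiv_linForm]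
    simp_rw [MvPolynomial.pderiv_mul, hX, map_add, map_mul, MvPolynomial.bind₁_X_right, mul_add,
      Finset.sum_add_distrib, Finset.sum_mul, apply_ite (MvPolynomial.bind₁ _),
      map_one, map_zero, mul_ite, mul_one, mul_zero]
    simp only [Finset.sum_ite_eq', Finset.mem_univ, if_true]
    congr 1
    · exact Finset.sum_congr rfl fun j _ => by ring
    · ring

/-- The Laplacian commutes with orthogonal changes of variables. -/
theorem polyLaplacian_bind₁_linForm {n : ℕ} {u : Fin n → Euc n}
    (hu : ∀ j k, ∑ i, u j i * u k i = if j = k then 1 else 0) (P : MvPolynomial (Fin n) ℝ) :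
    polyLaplacian n (MvPolynomial.bind₁ (fun j => linForm (u j)) P) =
      MvPolynomial.bind₁ (fun j => linForm (u j)) (polyLaplacian n P) := by
  simp only [polyLaplacian, LinearMap.sum_apply, LinearMap.comp_apply, Derivation.coeFn_coe,
    pderiv_bind₁_linForm, map_sum, Derivation.leibniz, MvPolynomial.pderiv_C, mul_zero, add_zero,
    smul_eq_mul, Finset.mul_sum]
  rw [Finset.sum_comm]
  refine Finset.sum_congr rfl fun j _ => ?_
  rw [Finset.sum_comm]
  have : ∀ k, ∑ i, MvPolynomial.C (u j i) * (MvPolynomial.C (u k i) *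
      MvPolynomial.bind₁ (fun j => linForm (u j))
        (MvPolynomial.pderiv k (MvPolynomial.pderiv j P))) =
      (if j = k then 1 else 0) * MvPolynomial.bind₁ (fun j => linForm (u j))
        (MvPolynomial.pderiv k (MvPolynomial.pderiv j P)) := by
    intro k
    simp_rw [← mul_assoc, ← Finset.sum_mul, ← map_mul, ← map_sum, hu]
    congr 1
    split_ifs <;> simp
  simp [this]

/-- The orthogonal group of `ℝⁿ`, with its topology as a group of operators. -/
abbrev OrthGroup (n : ℕ) : Type := unitary (Euc n →L[ℝ] Euc n)

/-- The action of the orthogonal group on the sphere. -/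
def rotate {n : ℕ} (g : OrthGroup n) (x : Sph n) : Sph n :=
  ⟨(g : Euc n →L[ℝ] Euc n) x, by
    rw [mem_sphere_zero_iff_norm, Unitary.norm_map]; exact mem_sphere_zero_iff_norm.1 x.2⟩

@[simp]
theorem coe_rotate {n : ℕ} (g : OrthGroup n) (x : Sph n) :
    (rotate g x : Euc n) = (g : Euc n →L[ℝ] Euc n) x := rfl

theorem rotate_mul {n : ℕ} (g h : OrthGroup n) (x : Sph n) :
    rotate (g * h) x = rotate g (rotate h x) := rfl

@[simp]
theorem rotate_inv_rotate {n : ℕ} (g : OrthGroup n) (x : Sph n) :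
    rotate g⁻¹ (rotate g x) = x := by
  rw [← rotate_mul, inv_mul_cancel]; rfl

@[simp]
theorem rotate_rotate_inv {n : ℕ} (g : OrthGroup n) (x : Sph n) :
    rotate g (rotate g⁻¹ x) = x := by
  rw [← rotate_mul, mul_inv_cancel]; rfl

theorem inner_inv_left {n : ℕ} (g : OrthGroup n) (x y : Euc n) :
    ⟪((g⁻¹ : OrthGroup n) : Euc n →L[ℝ] Euc n) x, y⟫ = ⟪x, (g : Euc n →L[ℝ] Euc n) y⟫ := by
  have h := Unitary.inner_map_map g (((g⁻¹ : OrthGroup n) : Euc n →L[ℝ] Euc n) x) y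
  have h2 : (g : Euc n →L[ℝ] Euc n) (((g⁻¹ : OrthGroup n) : Euc n →L[ℝ] Euc n) x) = x := by
    have := congrArg (fun k : OrthGroup n => (k : Euc n →L[ℝ] Euc n) x) (mul_inv_cancel g)
    exact this
  rw [h2] at h
  exact h.symm

/-- Polynomials are carried to polynomials by rotations, harmonic homogeneous ones to harmonic
homogeneous ones of the same degree. -/
theorem exists_rotated_polynomial {n ℓ : ℕ} (g : OrthGroup n) {P : MvPolynomial (Fin n) ℝ}
    (hP : P.IsHomogeneous ℓ) (hΔ : polyLaplacian n P = 0) :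
    ∃ Q : MvPolynomial (Fin n) ℝ, Q.IsHomogeneous ℓ ∧ polyLaplacian n Q = 0 ∧
      ∀ x : Euc n, MvPolynomial.eval (fun i => x i) Q =
        MvPolynomial.eval (fun i => (g : Euc n →L[ℝ] Euc n) x i) P := by
  set u : Fin n → Euc n := fun j =>
    ((g⁻¹ : OrthGroup n) : Euc n →L[ℝ] Euc n) (EuclideanSpace.single j 1) with hu
  refine ⟨MvPolynomial.bind₁ (fun j => linForm (u j)) P, ?_, ?_, ?_⟩
  · have := hP.aeval (fun j => linForm (u j)) (fun j => isHomogeneous_linForm (u j))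
    rw [one_mul] at this
    exact this
  · rw [polyLaplacian_bind₁_linForm, hΔ, map_zero]
    intro j k
    have := Unitary.inner_map_map (g⁻¹ : OrthGroup n) (EuclideanSpace.single j (1 : ℝ))
      (EuclideanSpace.single k (1 : ℝ))
    rw [PiLp.inner_apply] at this
    simp only [hu]
    simp only [EuclideanSpace.inner_single_left, PiLp.single_apply, map_one, one_mul] at this
    rw [← this]
    refine Finset.sum_congr rfl fun i _ => ?_
    simp [mul_comm]
  · intro x
    rw [MvPolynomial.eval, MvPolynomial.eval₂Hom_bind₁]
    change MvPolynomial.eval _ P = _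
    congr 1
    congr 1
    ext j
    have := eval_linForm (u j) x
    rw [hu, inner_inv_left] at this
    simpa [EuclideanSpace.inner_single_left] using this

/-- The space of spherical harmonics of a given degree is invariant under rotations. -/
theorem comp_rotate_mem_sphericalHarmonics {n ℓ : ℕ} (g : OrthGroup n) {Y : C(Sph n, ℝ)}
    (hY : Y ∈ sphericalHarmonics n ℓ) {Z : C(Sph n, ℝ)} (hZ : ∀ x, Z x = Y (rotate g x)) :
    Z ∈ sphericalHarmonics n ℓ := by
  obtain ⟨P, ⟨hP, hΔ⟩, rfl⟩ := hY
  obtain ⟨Q, hQ, hΔQ, hQP⟩ := exists_rotated_polynomial g hP hΔ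
  refine ⟨Q, ⟨hQ, hΔQ⟩, ?_⟩
  ext x
  rw [hZ]
  exact hQP x

/-! ### Gegenbauer polynomials and zonal harmonics -/

/-- The coefficient of `t ^ (ℓ - 2 * j) * (1 - t ^ 2) ^ j` in the Gegenbauer polynomial of degree
`ℓ` and order `(m - 1) / 2`. -/
def zonalCoeff (m ℓ j : ℕ) : ℝ :=
  (-1) ^ j * (ℓ.descFactorial (2 * j) : ℝ) *
    ∏ i ∈ Finset.range j, ((2 * (i : ℝ) + 2) * (2 * (i : ℝ) + m))⁻¹

theorem zonalCoeff_zero (m ℓ : ℕ) : zonalCoeff m ℓ 0 = 1 := by simp [zonalCoeff]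

theorem zonalCoeff_eq_zero {m ℓ j : ℕ} (h : ℓ < 2 * j) : zonalCoeff m ℓ j = 0 := by
  simp [zonalCoeff, Nat.descFactorial_eq_zero_iff_lt.2 h]

theorem cast_descFactorial_succ (a b : ℕ) :
    (a.descFactorial (b + 1) : ℝ) = ((a : ℝ) - b) * a.descFactorial b := by
  rw [Nat.descFactorial_succ]
  rcases le_or_gt b a with h | h
  · push_cast [h]; ring
  · simp [Nat.descFactorial_eq_zero_iff_lt.2 h]

/-- The recurrence that expresses harmonicity of the zonal polynomial. -/
theorem zonalCoeff_succ {m : ℕ} (hm : 0 < m) (ℓ j : ℕ) :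
    zonalCoeff m ℓ j * ((ℓ - 2 * j) * (ℓ - 2 * j - 1)) +
      zonalCoeff m ℓ (j + 1) * ((2 * j + 2) * (2 * j + m)) = 0 := by
  have hm' : (0 : ℝ) < m := by exact_mod_cast hm
  have h1 : (2 * (j : ℝ) + 2) ≠ 0 := by positivity
  have h2 : (2 * (j : ℝ) + m) ≠ 0 := by positivity
  unfold zonalCoeff
  rw [Finset.prod_range_succ, show 2 * (j + 1) = 2 * j + 1 + 1 by ring, cast_descFactorial_succ,
    cast_descFactorial_succ]
  push_cast
  field_simp
  ring

/-- The three-term recurrence of the Gegenbauer polynomials, on the level of coefficients. -/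
theorem zonalCoeff_three_term {m : ℕ} (hm : 0 < m) (ℓ j : ℕ) :
    ((ℓ : ℝ) + m) * zonalCoeff m (ℓ + 2) (j + 1) =
      (2 * ℓ + m + 1) * zonalCoeff m (ℓ + 1) (j + 1) -
        (ℓ + 1) * (zonalCoeff m ℓ (j + 1) + zonalCoeff m ℓ j) := by
  have hm' : (0 : ℝ) < m := by exact_mod_cast hm
  have h1 : (2 * (j : ℝ) + 2) ≠ 0 := by positivity
  have h2 : (2 * (j : ℝ) + m) ≠ 0 := by positivity
  unfold zonalCoeff
  rw [Finset.prod_range_succ, show 2 * (j + 1) = 2 * j + 1 + 1 by ring, cast_descFactorial_succ ℓ,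
    cast_descFactorial_succ ℓ, Nat.succ_descFactorial_succ (ℓ + 1),
    Nat.succ_descFactorial_succ ℓ, Nat.succ_descFactorial_succ ℓ]
  simp only [Nat.cast_mul, cast_descFactorial_succ ℓ]
  push_cast
  field_simp
  ring

/-- The polynomial `H` with `C_ℓ(t) = t ^ ℓ * H((1 - t ^ 2) / t ^ 2)`, where `C_ℓ` is the normalized
Gegenbauer polynomial of order `(m - 1) / 2`. -/
def zonalPoly (m ℓ : ℕ) : Polynomial ℝ :=
  ∑ j ∈ Finset.range (ℓ + 1), Polynomial.C (zonalCoeff m ℓ j) * Polynomial.X ^ j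

theorem coeff_zonalPoly (m ℓ j : ℕ) : (zonalPoly m ℓ).coeff j = zonalCoeff m ℓ j := by
  simp only [zonalPoly, Polynomial.finsetSum_coeff, Polynomial.coeff_C_mul_X_pow,
    Finset.sum_ite_eq, Finset.mem_range]
  split_ifs with h
  · rfl
  · exact (zonalCoeff_eq_zero (by omega)).symm

theorem zonalPoly_three_term {m : ℕ} (hm : 0 < m) (ℓ : ℕ) :
    Polynomial.C ((ℓ : ℝ) + m) * zonalPoly m (ℓ + 2) =
      Polynomial.C (2 * ℓ + m + 1 : ℝ) * zonalPoly m (ℓ + 1) -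
        Polynomial.C (ℓ + 1 : ℝ) * (zonalPoly m ℓ + Polynomial.X * zonalPoly m ℓ) := by
  ext j
  simp only [Polynomial.coeff_C_mul, Polynomial.coeff_sub, Polynomial.coeff_add, coeff_zonalPoly]
  cases j with
  | zero =>
    simp only [Polynomial.coeff_X_mul_zero, zonalCoeff_zero]
    ring
  | succ j =>
    rw [Polynomial.coeff_X_mul, coeff_zonalPoly]
    exact zonalCoeff_three_term hm ℓ j

theorem eval_gegenbauer {m : ℕ} (hm : 0 < m) {t : ℝ} (ht : t ≠ 0) (ℓ : ℕ) :
    (gegenbauer (((m : ℝ) - 1) / 2) ℓ).eval t =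
      t ^ ℓ * (zonalPoly m ℓ).eval ((1 - t ^ 2) / t ^ 2) := by
  induction ℓ using Nat.twoStepInduction with
  | zero => simp [gegenbauer, zonalPoly, zonalCoeff]
  | one =>
    simp [gegenbauer, zonalPoly, Finset.sum_range_succ, zonalCoeff_zero,
      zonalCoeff_eq_zero (show 1 < 2 * 1 by norm_num)]
  | more ℓ h0 h1 =>
    have hm' : (0 : ℝ) < m := by exact_mod_cast hm
    have hne : (ℓ : ℝ) + m ≠ 0 := by positivity
    have h := congrArg (Polynomial.eval ((1 - t ^ 2) / t ^ 2)) (zonalPoly_three_term hm ℓ)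
    simp only [Polynomial.eval_mul, Polynomial.eval_C, Polynomial.eval_sub, Polynomial.eval_add,
      Polynomial.eval_X] at h
    have e1 : (ℓ : ℝ) + 2 * ((m - 1) / 2) + 1 = ℓ + m := by ring
    have e2 : (2 : ℝ) * (ℓ + 1 + (m - 1) / 2) = 2 * ℓ + m + 1 := by ring
    simp only [gegenbauer, Polynomial.eval_mul, Polynomial.eval_sub, Polynomial.eval_C,
      Polynomial.eval_X, h0, h1, e1, e2]
    rw [inv_mul_eq_div, div_eq_iff hne]
    set A := (zonalPoly m (ℓ + 2)).eval ((1 - t ^ 2) / t ^ 2)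
    set B := (zonalPoly m (ℓ + 1)).eval ((1 - t ^ 2) / t ^ 2)
    set D := (zonalPoly m ℓ).eval ((1 - t ^ 2) / t ^ 2)
    have h' : t ^ (ℓ + 2) * A * (ℓ + m) = t ^ (ℓ + 2) * ((ℓ + m) * A) := by ring
    rw [h', h]
    field_simp
    ring

theorem eval_smul_of_isHomogeneous {n ℓ : ℕ} {P : MvPolynomial (Fin n) ℝ}
    (hP : P.IsHomogeneous ℓ) (c : ℝ) (x : Fin n → ℝ) :
    MvPolynomial.eval (fun i => c * x i) P = c ^ ℓ * MvPolynomial.eval x P := by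
  rw [MvPolynomial.eval_eq', MvPolynomial.eval_eq', Finset.mul_sum]
  refine Finset.sum_congr rfl fun d hd => ?_
  have : ∑ i, d i = ℓ := by
    rw [← Finsupp.degree_eq_sum, ← hP (MvPolynomial.mem_support_iff.1 hd),
      Finsupp.degree_eq_weight_one]
    rfl
  rw [← this, ← Finset.prod_pow_eq_pow_sum]
  simp only [mul_pow, Finset.prod_mul_distrib]
  ring

/-- The square of the distance from the first coordinate axis. -/
def radialSq (m : ℕ) : MvPolynomial (Fin (m + 1)) ℝ :=
  ∑ i : Fin m, MvPolynomial.X i.succ ^ 2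

/-- The Laplacian of a zonal monomial. The truncated exponents are harmless, since the factors in
front of them vanish where truncation occurs. -/
theorem polyLaplacian_zonal_monomial (m a j : ℕ) :
    polyLaplacian (m + 1) (MvPolynomial.X 0 ^ a * radialSq m ^ j) =
      MvPolynomial.C ((a : ℝ) * (a - 1)) * (MvPolynomial.X 0 ^ (a - 2) * radialSq m ^ j) +
      MvPolynomial.C ((2 * j : ℝ) * (2 * j + m - 2)) *
        (MvPolynomial.X 0 ^ a * radialSq m ^ (j - 1)) := by
  classical
  have hC2 : (MvPolynomial.C 2 : MvPolynomial (Fin (m + 1)) ℝ) = 2 := map_ofNat _ 2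
  have hC4 : (MvPolynomial.C 4 : MvPolynomial (Fin (m + 1)) ℝ) = 4 := map_ofNat _ 4
  have hd2 : ∀ i, MvPolynomial.pderiv i (2 : MvPolynomial (Fin (m + 1)) ℝ) = 0 := by
    intro i
    rw [← hC2, MvPolynomial.pderiv_C]
  have hR0 : MvPolynomial.pderiv 0 (radialSq m) = 0 := by
    simp [radialSq, Derivation.leibniz_pow, MvPolynomial.pderiv_X]
  have hRi : ∀ i : Fin m, MvPolynomial.pderiv i.succ (radialSq m) =
      2 * MvPolynomial.X i.succ := by
    intro i
    simp [radialSq, Derivation.leibniz_pow, MvPolynomial.pderiv_X, Pi.single_apply,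
      Fin.succ_inj]
  have hXi : ∀ i : Fin m, MvPolynomial.pderiv i.succ
      (MvPolynomial.X 0 : MvPolynomial (Fin (m + 1)) ℝ) = 0 := by
    intro i
    exact MvPolynomial.pderiv_X_of_ne (Fin.succ_ne_zero i).symm
  have h0 : MvPolynomial.pderiv 0 (MvPolynomial.pderiv 0
      (MvPolynomial.X 0 ^ a * radialSq m ^ j)) =
      MvPolynomial.C ((a : ℝ) * (a - 1)) * (MvPolynomial.X 0 ^ (a - 2) * radialSq m ^ j) := by
    rcases a with _ | _ | a <;>
    · simp [Derivation.leibniz_pow, hR0]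
      try ring
  have hi : ∀ i : Fin m, MvPolynomial.pderiv i.succ (MvPolynomial.pderiv i.succ
      (MvPolynomial.X 0 ^ a * radialSq m ^ j)) =
      MvPolynomial.X 0 ^ a * (MvPolynomial.C (4 * (j : ℝ) * (j - 1)) * radialSq m ^ (j - 2) *
        MvPolynomial.X i.succ ^ 2 + MvPolynomial.C (2 * (j : ℝ)) * radialSq m ^ (j - 1)) := by
    intro i
    rcases j with _ | _ | j <;>
    · simp [Derivation.leibniz_pow, hXi, hRi, hd2, hC2, hC4]
      try ring
  simp only [polyLaplacian, LinearMap.sum_apply, LinearMap.comp_apply, Derivation.coeFn_coe]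
  rw [Fin.sum_univ_succ, h0]
  simp_rw [hi]
  rw [← Finset.mul_sum, Finset.sum_add_distrib, ← Finset.mul_sum, ← radialSq]
  congr 1
  rcases j with _ | _ | j <;>
  · simp [hC2, hC4]
    try ring

theorem eval_radialSq {m : ℕ} (x : Fin (m + 1) → ℝ) :
    MvPolynomial.eval x (radialSq m) = ∑ i : Fin m, x i.succ ^ 2 := by
  simp [radialSq]

/-- The point with first coordinate `1`, one further coordinate `s`, and all others `0`. -/
def profilePoint {R : Type*} [Semiring R] {m : ℕ} (i₀ : Fin m) (s : R) : Fin (m + 1) → R :=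
  Fin.cons 1 fun i => if i = i₀ then s else 0

theorem sum_profilePoint_succ {m : ℕ} (i₀ : Fin m) (s : ℝ) :
    ∑ i : Fin m, profilePoint i₀ s i.succ ^ 2 = s ^ 2 := by
  simp [profilePoint, ite_pow]

/-- A polynomial in one variable that takes the same values at `s` and `-s` is a polynomial in
`s ^ 2`. -/
theorem eval_eq_sum_of_even {p : Polynomial ℝ} (hp : ∀ s, p.eval (-s) = p.eval s) {N : ℕ}
    (hN : p.natDegree ≤ N) (s : ℝ) :
    p.eval s = ∑ j ∈ Finset.range (N + 1), p.coeff (2 * j) * (s ^ 2) ^ j := by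
  have hodd : ∀ j, p.coeff (2 * j + 1) = 0 := by
    intro j
    have h : p.comp (Polynomial.C (-1) * Polynomial.X) = p := by
      refine Polynomial.funext fun r => ?_
      simp [Polynomial.eval_comp, hp]
    have h2 := congrArg (fun q => Polynomial.coeff q (2 * j + 1)) h
    simp only [Polynomial.comp_C_mul_X_coeff] at h2
    have h3 : (-1 : ℝ) ^ (2 * j + 1) = -1 := by simp [pow_succ, pow_mul]
    rw [h3] at h2
    linarith
  have hsplit : ∀ (g : ℕ → ℝ) (M : ℕ), ∑ k ∈ Finset.range (2 * M), g k =
      ∑ j ∈ Finset.range M, (g (2 * j) + g (2 * j + 1)) := by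
    intro g M
    induction M with
    | zero => simp
    | succ M ih =>
      rw [show 2 * (M + 1) = 2 * M + 1 + 1 by ring, Finset.sum_range_succ, Finset.sum_range_succ,
        Finset.sum_range_succ, ih]
      ring
  rw [Polynomial.eval_eq_sum_range' (show p.natDegree < 2 * (N + 1) by omega), hsplit]
  refine Finset.sum_congr rfl fun j _ => ?_
  rw [hodd, pow_mul]
  ring

/-- A harmonic polynomial whose coefficients with respect to the zonal monomials are `c j` satisfies
a two-term recurrence. -/
theorem zonal_recurrence {m ℓ : ℕ} (hm : 0 < m) {c : ℕ → ℝ} (hc : ∀ j, ℓ < 2 * j → c j = 0)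
    (hΔ : polyLaplacian (m + 1) (∑ j ∈ Finset.range (ℓ + 1),
      MvPolynomial.C (c j) * (MvPolynomial.X 0 ^ (ℓ - 2 * j) * radialSq m ^ j)) = 0) (j : ℕ) :
    c j * (((ℓ : ℝ) - 2 * j) * (ℓ - 2 * j - 1)) + c (j + 1) * ((2 * j + 2) * (2 * j + m)) = 0 := by
  set q : Polynomial ℝ := ∑ j ∈ Finset.range (ℓ + 1),
    (Polynomial.C (c j * (((ℓ : ℝ) - 2 * j) * (ℓ - 2 * j - 1))) * Polynomial.X ^ j +
      Polynomial.C (c j * ((2 * j : ℝ) * (2 * j + m - 2))) * Polynomial.X ^ (j - 1)) with hq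
  have hα : ∀ j, c j * (((ℓ - 2 * j : ℕ) : ℝ) * (((ℓ - 2 * j : ℕ) : ℝ) - 1)) =
      c j * (((ℓ : ℝ) - 2 * j) * (ℓ - 2 * j - 1)) := by
    intro j
    rcases lt_or_ge ℓ (2 * j) with h | h
    · simp [hc j h]
    · push_cast [h]; ring
  have hq0 : q = 0 := by
    apply Polynomial.eq_zero_of_infinite_isRoot
    refine (Set.Ici_infinite (0 : ℝ)).mono fun v hv => ?_
    have h := congrArg (MvPolynomial.eval (profilePoint ⟨0, hm⟩ (√v))) hΔ
    have hX : MvPolynomial.eval (profilePoint ⟨0, hm⟩ (√v)) (MvPolynomial.X 0) = 1 := by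
      simp [profilePoint]
    have hR : MvPolynomial.eval (profilePoint ⟨0, hm⟩ (√v)) (radialSq m) = v := by
      rw [eval_radialSq, sum_profilePoint_succ, Real.sq_sqrt hv]
    simp only [map_sum, ← MvPolynomial.smul_eq_C_mul, map_smul] at h
    simp only [polyLaplacian_zonal_monomial, MvPolynomial.smul_eq_C_mul, map_mul, map_add, map_pow,
      hX, hR, MvPolynomial.eval_C, one_pow, mul_add, ← mul_assoc, map_zero] at h
    change Polynomial.eval v q = 0
    rw [hq, Polynomial.eval_finsetSum, ← h]
    refine Finset.sum_congr rfl fun j _ => ?_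
    have := hα j
    simp only [Polynomial.eval_add, Polynomial.eval_mul, Polynomial.eval_C, Polynomial.eval_pow,
      Polynomial.eval_X]
    rw [← this]
    ring
  rcases lt_or_ge j ℓ with hj | hj
  · have h := congrArg (fun r => Polynomial.coeff r j) hq0
    simp only [hq, Polynomial.finsetSum_coeff, Polynomial.coeff_add, Polynomial.coeff_C_mul_X_pow,
      Polynomial.coeff_zero, Finset.sum_add_distrib, Finset.sum_ite_eq, Finset.mem_range] at h
    rw [if_pos (by omega), Finset.sum_eq_single (j + 1)] at h
    · rw [if_pos (by omega)] at h
      push_cast at h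
      linear_combination h
    · intro i _ hi
      split_ifs with hji
      · have : i = 0 := by omega
        simp [this]
      · rfl
    · intro hj'
      exact absurd (Finset.mem_range.2 (by omega)) hj'
  · rw [hc (j + 1) (by omega)]
    rcases Nat.eq_zero_or_pos ℓ with rfl | hℓ
    · rcases Nat.eq_zero_or_pos j with rfl | hj'
      · simp
      · rw [hc j (by omega)]; simp
    · rw [hc j (by omega)]; simp

/-- A homogeneous harmonic polynomial that is invariant under the rotations about the first
coordinate axis is, on the unit sphere, a multiple of a Gegenbauer polynomial of the first
coordinate. -/
theorem eval_eq_gegenbauer_of_zonal {m ℓ : ℕ} (hm : 0 < m) {P : MvPolynomial (Fin (m + 1)) ℝ}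
    (hP : P.IsHomogeneous ℓ) (hΔ : polyLaplacian (m + 1) P = 0)
    (hinv : ∀ x y : Fin (m + 1) → ℝ, x 0 = y 0 →
      ∑ i : Fin m, x i.succ ^ 2 = ∑ i : Fin m, y i.succ ^ 2 →
        MvPolynomial.eval x P = MvPolynomial.eval y P)
    {w : Fin (m + 1) → ℝ} (hw : w 0 ^ 2 + ∑ i : Fin m, w i.succ ^ 2 = 1) :
    MvPolynomial.eval w P = (gegenbauer (((m : ℝ) - 1) / 2) ℓ).eval (w 0) *
      MvPolynomial.eval (Pi.single 0 1) P := by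
  set i₀ : Fin m := ⟨0, hm⟩
  set p : Polynomial ℝ :=
    MvPolynomial.aeval (profilePoint i₀ (Polynomial.X : Polynomial ℝ)) P with hp
  have hpe : ∀ s, p.eval s = MvPolynomial.eval (profilePoint i₀ s) P := by
    intro s
    have : ((Polynomial.aeval s).comp
        (MvPolynomial.aeval (profilePoint i₀ (Polynomial.X : Polynomial ℝ)))) =
        MvPolynomial.aeval (R := ℝ) (profilePoint i₀ s) := by
      refine MvPolynomial.algHom_ext fun i => ?_
      refine Fin.cases ?_ (fun i => ?_) i
      · simp [profilePoint]
      · simp only [profilePoint, AlgHom.comp_apply, MvPolynomial.aeval_X, Fin.cons_succ]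
        split_ifs <;> simp
    have h := DFunLike.congr_fun this P
    simpa [hp, MvPolynomial.aeval_eq_eval] using h
  have hdeg : p.natDegree ≤ ℓ := by
    have h := MvPolynomial.aeval_natDegree_le P hP.totalDegree_le
      (profilePoint i₀ (Polynomial.X : Polynomial ℝ)) (n := 1) (fun i => by
        refine Fin.cases ?_ (fun i => ?_) i
        · simp [profilePoint]
        · simp only [profilePoint, Fin.cons_succ]
          split_ifs <;> simp)
    simpa using h
  have heven : ∀ s, p.eval (-s) = p.eval s := by
    intro s
    rw [hpe, hpe]
    refine hinv _ _ (by simp [profilePoint]) ?_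
    rw [sum_profilePoint_succ, sum_profilePoint_succ, neg_sq]
  set c : ℕ → ℝ := fun j => p.coeff (2 * j) with hc
  have hc0 : ∀ j, ℓ < 2 * j → c j = 0 := fun j hj =>
    Polynomial.coeff_eq_zero_of_natDegree_lt (by omega)
  have hsum := eval_eq_sum_of_even heven hdeg
  -- On `x 0 ≠ 0`, homogeneity and invariance reduce everything to the profile `p`.
  have hprof : ∀ x : Fin (m + 1) → ℝ, x 0 ≠ 0 → MvPolynomial.eval x P =
      x 0 ^ ℓ * p.eval (√(∑ i : Fin m, x i.succ ^ 2) / x 0) := by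
    intro x hx
    rw [hpe, ← eval_smul_of_isHomogeneous hP]
    refine hinv _ _ (by simp [profilePoint]) ?_
    simp_rw [mul_pow]
    rw [← Finset.mul_sum, sum_profilePoint_succ, div_pow,
      Real.sq_sqrt (Finset.sum_nonneg fun i _ => sq_nonneg _)]
    field_simp
  have hPsum : P = ∑ j ∈ Finset.range (ℓ + 1),
      MvPolynomial.C (c j) * (MvPolynomial.X 0 ^ (ℓ - 2 * j) * radialSq m ^ j) := by
    have h : MvPolynomial.X 0 * P = MvPolynomial.X 0 * ∑ j ∈ Finset.range (ℓ + 1),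
        MvPolynomial.C (c j) * (MvPolynomial.X 0 ^ (ℓ - 2 * j) * radialSq m ^ j) := by
      refine MvPolynomial.funext fun x => ?_
      rw [map_mul, map_mul, MvPolynomial.eval_X]
      rcases eq_or_ne (x 0) 0 with hx | hx
      · simp [hx]
      · rw [hprof x hx, hsum, map_sum, Finset.mul_sum]
        congr 1
        refine Finset.sum_congr rfl fun j _ => ?_
        rcases lt_or_ge ℓ (2 * j) with hj | hj
        · rw [show p.coeff (2 * j) = 0 from hc0 j hj, hc0 j hj]; simp
        · rw [map_mul, map_mul, MvPolynomial.eval_C, map_pow, map_pow, MvPolynomial.eval_X,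
            eval_radialSq, div_pow, Real.sq_sqrt (Finset.sum_nonneg fun i _ => sq_nonneg _), div_pow,
            ← pow_mul, ← Nat.sub_add_cancel hj, pow_add, Nat.add_sub_cancel]
          field_simp
          exact mul_comm _ _
    exact mul_left_cancel₀ (MvPolynomial.X_ne_zero 0) h
  have hrec := zonal_recurrence hm hc0 (hPsum ▸ hΔ)
  have hcz : ∀ j, c j = c 0 * zonalCoeff m ℓ j := by
    intro j
    induction j with
    | zero => simp [zonalCoeff_zero]
    | succ j ih =>
      have hm' : (0 : ℝ) < m := by exact_mod_cast hm
      have h1 : ((2 * (j : ℝ) + 2) * (2 * j + m)) ≠ 0 := by positivity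
      have h2 := hrec j
      have h3 := zonalCoeff_succ hm ℓ j
      rw [ih] at h2
      refine mul_right_cancel₀ h1 ?_
      linear_combination h2 - c 0 * h3
  have hpz : ∀ s, p.eval s = c 0 * (zonalPoly m ℓ).eval (s ^ 2) := by
    intro s
    rw [hsum, zonalPoly, Polynomial.eval_finsetSum, Finset.mul_sum]
    refine Finset.sum_congr rfl fun j _ => ?_
    rw [show p.coeff (2 * j) = c j from rfl, hcz j]
    simp
    ring
  have hpole : MvPolynomial.eval (Pi.single 0 1) P = c 0 := by
    have h := hpe 0
    rw [hpz] at h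
    have h1 : (profilePoint i₀ (0 : ℝ)) = Pi.single 0 1 := by
      ext i
      refine Fin.cases ?_ (fun i => ?_) i <;> simp [profilePoint]
    rw [h1] at h
    rw [← h]
    simp [← Polynomial.coeff_zero_eq_eval_zero, coeff_zonalPoly, zonalCoeff_zero]
  have hmain : ∀ x : Fin (m + 1) → ℝ, x 0 ≠ 0 → x 0 ^ 2 + ∑ i : Fin m, x i.succ ^ 2 = 1 →
      MvPolynomial.eval x P = (gegenbauer (((m : ℝ) - 1) / 2) ℓ).eval (x 0) * c 0 := by
    intro x hx hx1
    rw [hprof x hx, hpz, eval_gegenbauer hm hx, div_pow,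
      Real.sq_sqrt (Finset.sum_nonneg fun i _ => sq_nonneg _), ← hx1, add_sub_cancel_left]
    ring
  rw [hpole]
  rcases eq_or_ne (w 0) 0 with h0 | h0
  · -- The equator is reached by continuity along a meridian.
    rw [h0, zero_pow two_ne_zero, zero_add] at hw
    set γ : ℝ → Fin (m + 1) → ℝ := fun t => Fin.cons t fun i => √(1 - t ^ 2) * w i.succ with hγ
    have hγc : Continuous γ := by
      refine continuous_pi fun i => ?_
      refine Fin.cases ?_ (fun i => ?_) i
      · simpa [hγ] using continuous_id'
      · simp only [hγ, Fin.cons_succ]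
        fun_prop
    have hγ0 : γ 0 = w := by
      ext i
      refine Fin.cases ?_ (fun i => ?_) i <;> simp [hγ, h0]
    have hl : Filter.Tendsto (fun t => MvPolynomial.eval (γ t) P) (nhdsWithin 0 (Ioi 0))
        (nhds (MvPolynomial.eval w P)) := by
      have := ((MvPolynomial.continuous_eval P).comp hγc).tendsto 0
      simp only [Function.comp_apply, hγ0] at this
      exact this.mono_left nhdsWithin_le_nhds
    have hr : Filter.Tendsto (fun t => (gegenbauer (((m : ℝ) - 1) / 2) ℓ).eval t * c 0)
        (nhdsWithin 0 (Ioi 0)) (nhds ((gegenbauer (((m : ℝ) - 1) / 2) ℓ).eval (w 0) * c 0)) := by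
      rw [h0]
      exact (((Polynomial.continuous _).mul continuous_const).tendsto 0).mono_left
        nhdsWithin_le_nhds
    refine tendsto_nhds_unique (hl.congr' ?_) hr
    filter_upwards [Ioo_mem_nhdsGT (show (0 : ℝ) < 1 by norm_num)] with t ht
    have := hmain (γ t) (by simpa [hγ] using ht.1.ne') (by
      simp only [hγ, Fin.cons_zero, Fin.cons_succ, mul_pow]
      rw [← Finset.mul_sum, hw, Real.sq_sqrt (by nlinarith [ht.1, ht.2])]
      ring)
    simpa [hγ] using this
  · exact hmain w h0 hw

/-! ### Averages over the orthogonal group -/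

instance (n : ℕ) : ContinuousStar (Euc n →L[ℝ] Euc n) :=
  ⟨(ContinuousLinearMap.adjoint (𝕜 := ℝ) (E := Euc n) (F := Euc n)).continuous⟩

instance (n : ℕ) : CompactSpace (OrthGroup n) := by
  refine isCompact_iff_compactSpace.1 ?_
  have hcl : IsClosed ((unitary (Euc n →L[ℝ] Euc n) : Submonoid _) : Set (Euc n →L[ℝ] Euc n)) :=
    isClosed_unitary
  refine Metric.isCompact_of_isClosed_isBounded hcl ?_
  refine (isBounded_closedBall (x := (0 : Euc n →L[ℝ] Euc n)) (r := 1)).subset fun g hg => ?_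
  rw [mem_closedBall_zero_iff]
  refine ContinuousLinearMap.opNorm_le_bound _ zero_le_one fun x => ?_
  rw [one_mul]
  exact (Unitary.norm_map (⟨g, hg⟩ : OrthGroup n) x).le

theorem continuous_rotate {n : ℕ} :
    Continuous fun p : OrthGroup n × Sph n => rotate p.1 p.2 := by
  refine Continuous.subtype_mk ?_ _
  have h1 : Continuous fun p : OrthGroup n × Sph n => (p.1 : Euc n →L[ℝ] Euc n) :=
    continuous_subtype_val.comp continuous_fst
  exact h1.clm_apply (continuous_subtype_val.comp continuous_snd)

/-- The orthogonal group contains the reflection that exchanges two vectors of equal norm; it fixes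
the vectors orthogonal to their difference. -/
theorem exists_orthGroup_apply_eq {n : ℕ} {x y : Euc n} (h : ‖x‖ = ‖y‖) :
    ∃ g : OrthGroup n, (g : Euc n →L[ℝ] Euc n) x = y ∧
      ∀ v : Euc n, ⟪v, x⟫ = ⟪v, y⟫ → (g : Euc n →L[ℝ] Euc n) v = v := by
  refine ⟨Unitary.linearIsometryEquiv.symm (Submodule.reflection (ℝ ∙ (x - y))ᗮ), ?_, ?_⟩
  · exact Submodule.reflection_sub h
  · intro v hv
    refine Submodule.reflection_mem_subspace_eq_self ?_
    rw [Submodule.mem_orthogonal_singleton_iff_inner_left, inner_sub_right, hv, sub_self]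

theorem exists_rotate_eq {n : ℕ} (x y : Sph n) : ∃ g : OrthGroup n, rotate g x = y := by
  obtain ⟨g, hg, -⟩ := exists_orthGroup_apply_eq (x := (x : Euc n)) (y := (y : Euc n)) (by
    rw [mem_sphere_zero_iff_norm.1 x.2, mem_sphere_zero_iff_norm.1 y.2])
  exact ⟨g, Subtype.ext hg⟩

/-- A right-invariant probability measure on the orthogonal group: the image of the left-invariant
Haar measure of total mass one under inversion. -/
def orthMeasure (n : ℕ) : Measure (OrthGroup n) :=
  (Measure.haarMeasure (⊤ : TopologicalSpace.PositiveCompacts (OrthGroup n))).inv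

instance (n : ℕ) : (orthMeasure n).IsMulRightInvariant := by
  unfold orthMeasure; infer_instance

instance (n : ℕ) : IsProbabilityMeasure (orthMeasure n) := by
  constructor
  rw [orthMeasure, Measure.inv_apply, Set.inv_univ]
  exact Measure.haarMeasure_self

theorem integral_orthMeasure_mul_right {n : ℕ} (F : OrthGroup n → ℝ) (h : OrthGroup n) :
    ∫ g, F (g * h) ∂(orthMeasure n) = ∫ g, F g ∂(orthMeasure n) :=
  integral_mul_right_eq_self F h

/-- The action of a rotation as a homeomorphism of the sphere. -/
def rotateHomeomorph {n : ℕ} (g : OrthGroup n) : Sph n ≃ₜ Sph n where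
  toFun := rotate g
  invFun := rotate g⁻¹
  left_inv := rotate_inv_rotate g
  right_inv := rotate_rotate_inv g
  continuous_toFun := continuous_rotate.comp (Continuous.prodMk_right g)
  continuous_invFun := continuous_rotate.comp (Continuous.prodMk_right g⁻¹)

open scoped Pointwise in
theorem measurePreserving_rotate {n : ℕ} (g : OrthGroup n) :
    MeasurePreserving (rotate g) (sphMeasure n) (sphMeasure n) := by
  refine ⟨(rotateHomeomorph g).continuous.measurable, ?_⟩
  have hmeas : Measurable (rotate g) := (rotateHomeomorph g).continuous.measurable
  ext s hs
  rw [Measure.map_apply hmeas hs, Measure.toSphere_apply' _ (hmeas hs), Measure.toSphere_apply' _ hs]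
  congr 1
  set L := Unitary.linearIsometryEquiv g with hL
  have hLg : ∀ x, L x = (g : Euc n →L[ℝ] Euc n) x := fun x => rfl
  have himg : Ioo (0 : ℝ) 1 • ((↑) '' s : Set (Euc n)) =
      L '' (Ioo (0 : ℝ) 1 • ((↑) '' (rotate g ⁻¹' s))) := by
    ext x
    simp only [Set.mem_smul, mem_image, mem_preimage]
    constructor
    · rintro ⟨r, hr, _, ⟨y, hy, rfl⟩, rfl⟩
      refine ⟨r • (rotate g⁻¹ y : Sph n), ⟨r, hr, _, ⟨rotate g⁻¹ y, by simpa using hy, rfl⟩, rfl⟩, ?_⟩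
      rw [map_smul, hLg, ← coe_rotate, rotate_rotate_inv]
    · rintro ⟨_, ⟨r, hr, _, ⟨y, hy, rfl⟩, rfl⟩, rfl⟩
      exact ⟨r, hr, _, ⟨rotate g y, hy, rfl⟩, by rw [map_smul, hLg, coe_rotate]⟩
  have himg' : ∀ T : Set (Euc n), L '' T = L.symm ⁻¹' T := L.toEquiv.image_eq_preimage_symm
  rw [himg, himg']
  exact (L.symm.measurePreserving.measure_preimage_emb
    L.symm.toHomeomorph.measurableEmbedding _).symm

/-- Integration over the sphere is averaging over the orthogonal group. -/
theorem integral_sphMeasure_eq_integral_orthMeasure {n : ℕ} {h : Sph n → ℝ} (hh : Continuous h)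
    (x₀ : Sph n) :
    ∫ x, h x ∂(sphMeasure n) = sphArea n * ∫ g, h (rotate g x₀) ∂(orthMeasure n) := by
  have h1 : ∀ g : OrthGroup n, ∫ x, h (rotate g x) ∂(sphMeasure n) = ∫ x, h x ∂(sphMeasure n) :=
    fun g => (measurePreserving_rotate g).integral_comp
      (rotateHomeomorph g).measurableEmbedding h
  have h2 : ∀ x, ∫ g, h (rotate g x) ∂(orthMeasure n) =
      ∫ g, h (rotate g x₀) ∂(orthMeasure n) := by
    intro x
    obtain ⟨k, rfl⟩ := exists_rotate_eq x₀ x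
    exact integral_orthMeasure_mul_right (fun g => h (rotate g x₀)) k
  have hswap : ∫ g, ∫ x, h (rotate g x) ∂(sphMeasure n) ∂(orthMeasure n) =
      ∫ x, ∫ g, h (rotate g x) ∂(orthMeasure n) ∂(sphMeasure n) :=
    integral_integral_swap_of_hasCompactSupport
      (f := fun (g : OrthGroup n) x => h (rotate g x)) (hh.comp continuous_rotate)
      (HasCompactSupport.of_compactSpace _)
  simp only [h1, h2, integral_const, smul_eq_mul, probReal_univ, one_mul] at hswap
  rw [hswap, sphArea]

/-! ### The mean value property of spherical harmonics -/

/-- Finite dimension makes the space of spherical harmonics closed, so that it contains averages of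
its elements. -/
instance (n ℓ : ℕ) : FiniteDimensional ℝ (sphericalHarmonics n ℓ) := by
  have h1 : FiniteDimensional ℝ (MvPolynomial.homogeneousSubmodule (Fin n) ℝ ℓ) :=
    Module.Finite.iff_fg.2 (MvPolynomial.homogeneousSubmodule_fg (Fin n) ℝ ℓ)
  have h2 : FiniteDimensional ℝ ↥(MvPolynomial.homogeneousSubmodule (Fin n) ℝ ℓ ⊓
      LinearMap.ker (polyLaplacian n)) :=
    Submodule.finiteDimensional_of_le inf_le_left
  unfold sphericalHarmonics
  infer_instance

/-- The first unit vector, as a point of the sphere. -/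
def pole (m : ℕ) : Sph (m + 1) := ⟨EuclideanSpace.single 0 1, by simp⟩

/-- A spherical harmonic that is invariant under the rotations about the pole is a multiple of a
Gegenbauer polynomial. -/
theorem eq_gegenbauer_of_rotate_invariant {m ℓ : ℕ} (hm : 0 < m) {Q : C(Sph (m + 1), ℝ)}
    (hQ : Q ∈ sphericalHarmonics (m + 1) ℓ)
    (hinv : ∀ k : OrthGroup (m + 1), rotate k (pole m) = pole m → ∀ w, Q (rotate k w) = Q w)
    (w : Sph (m + 1)) :
    Q w = (gegenbauer (((m : ℝ) - 1) / 2) ℓ).eval ⟪(w : Euc (m + 1)), (pole m : Euc (m + 1))⟫ *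
      Q (pole m) := by
  obtain ⟨P, ⟨hP, hΔ⟩, rfl⟩ := hQ
  have hw : (w : Euc (m + 1)) 0 ^ 2 + ∑ i : Fin m, (w : Euc (m + 1)) i.succ ^ 2 = 1 := by
    have h := mem_sphere_zero_iff_norm.1 w.2
    rw [EuclideanSpace.norm_eq, Real.sqrt_eq_one, Fin.sum_univ_succ] at h
    simpa using h
  have key := eval_eq_gegenbauer_of_zonal hm hP hΔ (fun x y h0 hs => ?_) hw
  · have e1 : ⟪(w : Euc (m + 1)), (pole m : Euc (m + 1))⟫ = (w : Euc (m + 1)) 0 := by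
      simp [pole, EuclideanSpace.inner_single_right]
    rw [e1]
    have e2 : restrictSph (m + 1) P (pole m) = MvPolynomial.eval (Pi.single 0 1) P := by
      simp only [restrictSph, LinearMap.coe_mk, AddHom.coe_mk, ContinuousMap.coe_mk, pole]
      congr 1
    rw [e2]
    exact key
  · have hn : ∀ z : Fin (m + 1) → ℝ,
        ‖(WithLp.toLp 2 z : Euc (m + 1))‖ = √(z 0 ^ 2 + ∑ i : Fin m, z i.succ ^ 2) := by
      intro z
      rw [EuclideanSpace.norm_eq, Fin.sum_univ_succ]
      simp
    set X : Euc (m + 1) := WithLp.toLp 2 x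
    set Z : Euc (m + 1) := WithLp.toLp 2 y
    have hXZ : ‖X‖ = ‖Z‖ := by rw [hn, hn, h0, hs]
    -- The reflection that exchanges `X` and `Z` fixes the pole, as they have equal first coordinate.
    obtain ⟨k, hk, hkf⟩ := exists_orthGroup_apply_eq hXZ
    have hkp : rotate k (pole m) = pole m := Subtype.ext <| hkf _ <| by
      simpa [pole, EuclideanSpace.inner_single_left, X, Z] using h0
    rcases eq_or_ne ‖X‖ 0 with hX0 | hX0
    · have hX1 : X = 0 := norm_eq_zero.1 hX0
      have hZ1 : Z = 0 := norm_eq_zero.1 (hXZ ▸ hX0)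
      have : x = y := by
        have := congrArg (fun v : Euc (m + 1) => v.ofLp) (hX1.trans hZ1.symm)
        exact this
      rw [this]
    · -- Homogeneity reduces the claim to the unit sphere.
      set ξ : Sph (m + 1) := ⟨‖X‖⁻¹ • X, by simp [norm_smul, hX0]⟩ with hξ
      have h1 := hinv k hkp ξ
      have hs1 : ∀ v : Fin (m + 1) → ℝ,
          MvPolynomial.eval v P = ‖X‖ ^ ℓ * MvPolynomial.eval (fun i => ‖X‖⁻¹ * v i) P := by
        intro v
        rw [eval_smul_of_isHomogeneous hP, ← mul_assoc, ← mul_pow, mul_inv_cancel₀ hX0, one_pow,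
          one_mul]
      rw [hs1 x, hs1 y]
      congr 1
      refine Eq.trans ?_ (h1.symm.trans ?_)
      · rfl
      · simp only [restrictSph, LinearMap.coe_mk, AddHom.coe_mk, ContinuousMap.coe_mk]
        congr 1
        congr 1
        ext i
        rw [coe_rotate, hξ]
        simp [hk, Z]

/-- The mean value property: averaging `φ (g θ) * Y (g w)` over the rotations `g` multiplies the
coefficient of `φ` by the Gegenbauer polynomial at `⟪w, θ⟫`. -/
theorem integral_orthMeasure_mul_eq {m ℓ : ℕ} (hm : 0 < m) {Y : C(Sph (m + 1), ℝ)}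
    (hY : Y ∈ sphericalHarmonics (m + 1) ℓ) (φ : C(Sph (m + 1), ℝ)) (w θ : Sph (m + 1)) :
    sphArea (m + 1) * ∫ g, φ (rotate g θ) * Y (rotate g w) ∂(orthMeasure (m + 1)) =
      (gegenbauer (((m : ℝ) - 1) / 2) ℓ).eval ⟪(w : Euc (m + 1)), (θ : Euc (m + 1))⟫ *
        ∫ x, φ x * Y x ∂(sphMeasure (m + 1)) := by
  set p := pole m
  -- The convolution `Q` of `Y` with `φ` is a zonal spherical harmonic.
  let F : C(OrthGroup (m + 1), C(Sph (m + 1), ℝ)) := ContinuousMap.curry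
    ⟨fun q => φ (rotate q.1 p) * Y (rotate q.1 q.2), by
      refine (φ.continuous.comp ?_).mul (Y.continuous.comp continuous_rotate)
      exact continuous_rotate.comp (continuous_fst.prodMk continuous_const)⟩
  have hFi : Integrable F (orthMeasure (m + 1)) :=
    F.continuous.integrable_of_hasCompactSupport (HasCompactSupport.of_compactSpace _)
  set Q : C(Sph (m + 1), ℝ) := ∫ g, F g ∂(orthMeasure (m + 1)) with hQ
  have hQw : ∀ v, Q v = ∫ g, φ (rotate g p) * Y (rotate g v) ∂(orthMeasure (m + 1)) := by
    intro v
    rw [hQ, ContinuousMap.integral_apply hFi]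
    rfl
  have hQmem : Q ∈ sphericalHarmonics (m + 1) ℓ := by
    refine Convex.integral_mem (sphericalHarmonics (m + 1) ℓ).convex
      (Submodule.closed_of_finiteDimensional _) (Filter.Eventually.of_forall fun g => ?_) hFi
    have hYg : (⟨fun v => Y (rotate g v), Y.continuous.comp
        (rotateHomeomorph g).continuous⟩ : C(Sph (m + 1), ℝ)) ∈ sphericalHarmonics (m + 1) ℓ :=
      comp_rotate_mem_sphericalHarmonics g hY fun v => rfl
    exact (sphericalHarmonics (m + 1) ℓ).smul_mem (φ (rotate g p)) hYg
  have hQinv : ∀ k : OrthGroup (m + 1), rotate k p = p → ∀ v, Q (rotate k v) = Q v := by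
    intro k hk v
    rw [hQw, hQw,
      ← integral_orthMeasure_mul_right (fun g => φ (rotate g p) * Y (rotate g v)) k]
    refine integral_congr_ae (Filter.Eventually.of_forall fun g => ?_)
    simp only [rotate_mul, hk]
  have hzonal := eq_gegenbauer_of_rotate_invariant hm hQmem hQinv
  obtain ⟨h, rfl⟩ := exists_rotate_eq p θ
  have h1 : ∫ g, φ (rotate g (rotate h p)) * Y (rotate g w) ∂(orthMeasure (m + 1)) =
      Q (rotate h⁻¹ w) := by
    rw [hQw, ← integral_orthMeasure_mul_right
      (fun g => φ (rotate g p) * Y (rotate g (rotate h⁻¹ w))) h]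
    refine integral_congr_ae (Filter.Eventually.of_forall fun g => ?_)
    simp only [rotate_mul, rotate_rotate_inv]
  rw [h1, hzonal, integral_sphMeasure_eq_integral_orthMeasure
    (h := fun x => φ x * Y x) (by fun_prop) p, ← hQw, coe_rotate, coe_rotate, inner_inv_left]
  ring

/-! ### The area formula for maps with constant Jacobian -/

/-- If the distances between the values of `u` are at most `K` times those between the values of
`v`, then the image of `u` has at most `K ^ d` times the `d`-dimensional measure of that of `v`. -/
theorem euclideanHausdorffMeasure_image_le_of_dist_le {α X Z : Type*} [MetricSpace X]
    [MeasurableSpace X] [BorelSpace X] [MetricSpace Z] [MeasurableSpace Z] [BorelSpace Z]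
    {s : Set α} {u : α → X} {v : α → Z} {K : NNReal}
    (h : ∀ a ∈ s, ∀ b ∈ s, dist (u a) (u b) ≤ K * dist (v a) (v b)) (d : ℕ) :
    Measure.euclideanHausdorffMeasure d (u '' s) ≤
      (K : ENNReal) ^ d * Measure.euclideanHausdorffMeasure d (v '' s) := by
  rcases s.eq_empty_or_nonempty with rfl | ⟨a₀, -⟩
  · simp
  have : Nonempty α := ⟨a₀⟩
  set g := Function.invFunOn v s with hg
  have hgs : ∀ a ∈ s, g (v a) ∈ s ∧ v (g (v a)) = v a := fun a ha =>
    ⟨Function.invFunOn_mem ⟨a, ha, rfl⟩, Function.invFunOn_eq ⟨a, ha, rfl⟩⟩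
  have hlip : LipschitzOnWith K (u ∘ g) (v '' s) := by
    refine LipschitzOnWith.of_dist_le_mul ?_
    rintro _ ⟨a, ha, rfl⟩ _ ⟨b, hb, rfl⟩
    have := h _ (hgs a ha).1 _ (hgs b hb).1
    rwa [(hgs a ha).2, (hgs b hb).2] at this
  have hsub : u '' s ⊆ (u ∘ g) '' (v '' s) := by
    rintro _ ⟨a, ha, rfl⟩
    refine ⟨v a, ⟨a, ha, rfl⟩, ?_⟩
    have := h _ (hgs a ha).1 _ ha
    rw [(hgs a ha).2, dist_self, mul_zero] at this
    exact dist_le_zero.1 this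
  have := (measure_mono hsub).trans (hlip.hausdorffMeasure_image_le (Nat.cast_nonneg d))
  rw [ENNReal.rpow_natCast] at this
  simp_rw [Measure.euclideanHausdorffMeasure_def, Measure.smul_apply]
  rw [mul_smul_comm]
  gcongr

/-- The area formula for an injective differentiable map whose Jacobian is constant. -/
theorem euclideanHausdorffMeasure_image_of_normDet_eq {E F : Type*} [NormedAddCommGroup E]
    [InnerProductSpace ℝ E] [FiniteDimensional ℝ E] [MeasurableSpace E] [BorelSpace E]
    [NormedAddCommGroup F] [InnerProductSpace ℝ F] [FiniteDimensional ℝ F] [MeasurableSpace F]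
    [BorelSpace F] {Φ : E → F} {Φ' : E → E →L[ℝ] F} {s : Set E} (hs : MeasurableSet s)
    (hΦ : ∀ x ∈ s, HasFDerivWithinAt Φ (Φ' x) s x) (hinj : InjOn Φ s) {J : ℝ} (hJ : 0 < J)
    (hdet : ∀ x ∈ s, (Φ' x).toLinearMap.normDet = J) :
    Measure.euclideanHausdorffMeasure (Module.finrank ℝ E) (Φ '' s) =
      ENNReal.ofReal J * volume s := by
  rcases s.eq_empty_or_nonempty with rfl | hne
  · simp
  set d := Module.finrank ℝ E with hd
  have hcont : ContinuousOn Φ s := fun x hx => (hΦ x hx).continuousWithinAt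
  -- Up to a factor close to `1`, the map is locally isometric to its derivative.
  have key : ∀ ε ∈ Ioo (0 : ℝ) 1,
      Measure.euclideanHausdorffMeasure d (Φ '' s) ≤
        ENNReal.ofReal (1 + ε) ^ d * (ENNReal.ofReal J * volume s) ∧
      ENNReal.ofReal J * volume s ≤
        ENNReal.ofReal (1 - ε)⁻¹ ^ d * Measure.euclideanHausdorffMeasure d (Φ '' s) := by
    intro ε hε
    have hr : ∀ A : E →L[ℝ] F, ∃ r : NNReal, r ≠ 0 ∧ (A.toLinearMap.normDet = J →
        ∀ x, r * ‖x‖ ≤ ε * ‖A x‖) := by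
      intro A
      by_cases hA : A.toLinearMap.normDet = J
      · have hker : LinearMap.ker A.toLinearMap = ⊥ := by
          by_contra hk
          exact hJ.ne' (hA ▸ LinearMap.normDet_eq_zero_iff_ker_ne_bot.2 hk)
        obtain ⟨K, hK, hKA⟩ := A.toLinearMap.exists_antilipschitzWith hker
        refine ⟨ε.toNNReal / K, (div_pos (Real.toNNReal_pos.2 hε.1) hK).ne', fun _ x => ?_⟩
        have hx := hKA.le_mul_dist x 0
        simp only [dist_zero_right, map_zero, ContinuousLinearMap.coe_coe] at hx
        have hK' : (0 : ℝ) < K := hK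
        rw [NNReal.coe_div, Real.coe_toNNReal _ hε.1.le, div_mul_eq_mul_div, div_le_iff₀ hK']
        nlinarith [mul_le_mul_of_nonneg_left hx hε.1.le]
      · exact ⟨1, one_ne_zero, fun h => absurd h hA⟩
    choose r hr0 hr using hr
    obtain ⟨t, A, htd, htm, hst, happ, hA⟩ :=
      exists_partition_approximatesLinearOn_of_hasFDerivWithinAt Φ s Φ' hΦ r hr0
    have hAJ : ∀ n, (A n).toLinearMap.normDet = J := by
      intro n
      obtain ⟨y, hy, hAy⟩ := hA hne n
      rw [hAy, hdet y hy]
    have hclose : ∀ n, ∀ x ∈ s ∩ t n, ∀ y ∈ s ∩ t n,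
        ‖(Φ x - Φ y) - (A n x - A n y)‖ ≤ ε * ‖A n x - A n y‖ := by
      intro n x hx y hy
      have h := happ n x hx y hy
      rw [map_sub] at h
      refine h.trans ?_
      rw [← map_sub]
      exact hr _ (hAJ n) _
    have himgA : ∀ n, Measure.euclideanHausdorffMeasure d (A n '' (s ∩ t n)) =
        ENNReal.ofReal J * volume (s ∩ t n) := by
      intro n
      rw [← hAJ n]
      exact (A n).toLinearMap.euclideanHausdorffMeasure_image_eq_normDet_mul_volume _
    have hup : ∀ n, Measure.euclideanHausdorffMeasure d (Φ '' (s ∩ t n)) ≤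
        ENNReal.ofReal (1 + ε) ^ d * (ENNReal.ofReal J * volume (s ∩ t n)) := by
      intro n
      rw [← himgA]
      refine euclideanHausdorffMeasure_image_le_of_dist_le (fun x hx y hy => ?_) d
      rw [Real.coe_toNNReal _ (by linarith [hε.1]), dist_eq_norm, dist_eq_norm]
      have h1 := hclose n x hx y hy
      have h2 := norm_add_le ((Φ x - Φ y) - (A n x - A n y)) (A n x - A n y)
      rw [sub_add_cancel] at h2
      linarith
    have hlow : ∀ n, ENNReal.ofReal J * volume (s ∩ t n) ≤
        ENNReal.ofReal (1 - ε)⁻¹ ^ d *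
          Measure.euclideanHausdorffMeasure d (Φ '' (s ∩ t n)) := by
      intro n
      rw [← himgA]
      refine euclideanHausdorffMeasure_image_le_of_dist_le (fun x hx y hy => ?_) d
      have hε1 : 0 < 1 - ε := by linarith [hε.2]
      rw [Real.coe_toNNReal _ (inv_pos.2 hε1).le, dist_eq_norm, dist_eq_norm,
        inv_mul_eq_div, le_div_iff₀ hε1]
      have h1 := hclose n x hx y hy
      have h2 := norm_sub_le (Φ x - Φ y) ((Φ x - Φ y) - (A n x - A n y))
      rw [sub_sub_cancel] at h2
      nlinarith
    have hpm : ∀ n, MeasurableSet (s ∩ t n) := fun n => hs.inter (htm n)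
    have hpd : Pairwise (Function.onFun Disjoint fun n => s ∩ t n) := fun i j hij =>
      (htd hij).mono inter_subset_right inter_subset_right
    have hunion : s = ⋃ n, s ∩ t n := by
      rw [← inter_iUnion, inter_eq_left.2 hst]
    have hvol : volume s = ∑' n, volume (s ∩ t n) := by
      conv_lhs => rw [hunion]
      exact measure_iUnion hpd hpm
    have himg : Measure.euclideanHausdorffMeasure d (Φ '' s) =
        ∑' n, Measure.euclideanHausdorffMeasure d (Φ '' (s ∩ t n)) := by
      conv_lhs => rw [hunion, image_iUnion]
      refine measure_iUnion (fun i j hij => ?_) fun n =>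
        (hpm n).image_of_continuousOn_injOn (hcont.mono inter_subset_left)
          (hinj.mono inter_subset_left)
      exact disjoint_image_image fun x hx y hy hxy =>
        Set.disjoint_left.1 (hpd hij) hx (hinj hx.1 hy.1 hxy ▸ hy)
    rw [himg, hvol, ← ENNReal.tsum_mul_left, ← ENNReal.tsum_mul_left, ← ENNReal.tsum_mul_left]
    exact ⟨ENNReal.tsum_le_tsum hup, ENNReal.tsum_le_tsum hlow⟩
  have hmem : ∀ᶠ ε in nhdsWithin (0 : ℝ) (Ioi 0), ε ∈ Ioo (0 : ℝ) 1 := Ioo_mem_nhdsGT one_pos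
  have hlim : ∀ (q : ℝ → ℝ) (c : ENNReal), ContinuousAt q 0 → q 0 = 1 →
      Filter.Tendsto (fun ε => ENNReal.ofReal (q ε) ^ d * c) (nhdsWithin 0 (Ioi 0)) (nhds c) := by
    intro q c hq hq0
    have h1 : Filter.Tendsto (fun ε => ENNReal.ofReal (q ε) ^ d) (nhdsWithin 0 (Ioi 0))
        (nhds 1) := by
      have := (ENNReal.continuous_pow d).continuousAt.tendsto.comp
        ((ENNReal.continuous_ofReal.continuousAt (x := q 0)).tendsto.comp hq.tendsto)
      rw [hq0, ENNReal.ofReal_one, one_pow] at this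
      exact this.mono_left nhdsWithin_le_nhds
    have := ENNReal.Tendsto.mul_const (b := c) h1 (Or.inl one_ne_zero)
    rwa [one_mul] at this
  refine le_antisymm ?_ ?_
  · refine ge_of_tendsto (hlim (fun ε => 1 + ε) _ (by fun_prop) (by simp)) ?_
    filter_upwards [hmem] with ε hε using (key ε hε).1
  · refine ge_of_tendsto (hlim (fun ε => (1 - ε)⁻¹) _ ?_ (by simp)) ?_
    · exact ContinuousAt.inv₀ (by fun_prop) (by simp)
    · filter_upwards [hmem] with ε hε using (key ε hε).2

/-! ### The surface measure of a cone -/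

/-- `J` is an isometric parametrization of the hyperplane orthogonal to `e`. -/
def IsTangentFrame {m : ℕ} (e : Euc (m + 1)) (J : Euc m →ₗᵢ[ℝ] Euc (m + 1)) : Prop :=
  ∀ x, ⟪x, e⟫ = 0 ↔ x ∈ range J

theorem IsTangentFrame.inner_eq_zero {m : ℕ} {e : Euc (m + 1)} {J : Euc m →ₗᵢ[ℝ] Euc (m + 1)}
    (h : IsTangentFrame e J) (y : Euc m) : ⟪J y, e⟫ = 0 := (h _).2 ⟨y, rfl⟩

theorem exists_isTangentFrame {m : ℕ} {e : Euc (m + 1)} (he : e ≠ 0) :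
    ∃ J : Euc m →ₗᵢ[ℝ] Euc (m + 1), IsTangentFrame e J := by
  have : Fact (Module.finrank ℝ (Euc (m + 1)) = m + 1) := ⟨by simp⟩
  set b := OrthonormalBasis.fromOrthogonalSpanSingleton (𝕜 := ℝ) m he
  refine ⟨(ℝ ∙ e)ᗮ.subtypeₗᵢ.comp b.repr.symm.toLinearIsometry, fun x => ?_⟩
  rw [← Submodule.mem_orthogonal_singleton_iff_inner_left]
  constructor
  · intro hx
    exact ⟨b.repr ⟨x, hx⟩, by simp⟩
  · rintro ⟨y, rfl⟩
    exact (b.repr.symm y).2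

/-- The graph parametrization of the cone with vertex `e` by its tangent hyperplane. -/
def coneMap {m : ℕ} (e : Euc (m + 1)) (J : Euc m →ₗᵢ[ℝ] Euc (m + 1)) (c : ℝ) (y : Euc m) :
    Euc (m + 1) := (1 - c * ‖y‖) • e + J y

section ConeMap

variable {m : ℕ} {e : Euc (m + 1)} {J : Euc m →ₗᵢ[ℝ] Euc (m + 1)} {c : ℝ}

theorem continuous_coneMap : Continuous (coneMap e J c) := by
  unfold coneMap
  have := J.continuous
  fun_prop

theorem inner_coneMap (he : ‖e‖ = 1) (hJ : IsTangentFrame e J) (y : Euc m) :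
    ⟪e, coneMap e J c y⟫ = 1 - c * ‖y‖ := by
  rw [coneMap, inner_add_right, inner_smul_right, real_inner_self_eq_norm_sq, he,
    real_inner_comm, hJ.inner_eq_zero]
  ring

theorem norm_smul_add_sq (he : ‖e‖ = 1) (hJ : IsTangentFrame e J) (a : ℝ) (y : Euc m) :
    ‖a • e + J y‖ ^ 2 = a ^ 2 + ‖y‖ ^ 2 := by
  rw [norm_add_sq_real, inner_smul_left, real_inner_comm, hJ.inner_eq_zero, norm_smul, he,
    J.norm_map]
  simp

theorem norm_coneMap_sq (he : ‖e‖ = 1) (hJ : IsTangentFrame e J) (y : Euc m) :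
    ‖coneMap e J c y‖ ^ 2 = (1 - c * ‖y‖) ^ 2 + ‖y‖ ^ 2 := norm_smul_add_sq he hJ _ y

theorem norm_coneMap_sub (he : ‖e‖ = 1) (hJ : IsTangentFrame e J) (y : Euc m) :
    ‖coneMap e J c y - e‖ = √(c ^ 2 + 1) * ‖y‖ := by
  have h : coneMap e J c y - e = (-(c * ‖y‖)) • e + J y := by
    rw [coneMap]; module
  rw [← Real.sqrt_sq (norm_nonneg (coneMap e J c y - e)), h, norm_smul_add_sq he hJ,
    show (-(c * ‖y‖)) ^ 2 + ‖y‖ ^ 2 = (c ^ 2 + 1) * ‖y‖ ^ 2 by ring,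
    Real.sqrt_mul (by positivity), Real.sqrt_sq (norm_nonneg y)]

theorem injective_coneMap (he : ‖e‖ = 1) (hJ : IsTangentFrame e J) :
    Function.Injective (coneMap e J c) := by
  intro x y h
  have h1 : c * ‖x‖ = c * ‖y‖ := by
    have := congrArg (fun v => ⟪e, v⟫) h
    simp only [inner_coneMap he hJ] at this
    linarith
  simp only [coneMap, h1] at h
  exact J.injective (add_left_cancel h)

theorem measurableEmbedding_coneMap (he : ‖e‖ = 1) (hJ : IsTangentFrame e J) :
    MeasurableEmbedding (coneMap e J c) :=
  continuous_coneMap.measurableEmbedding (injective_coneMap he hJ)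

/-- The derivative of the graph parametrization away from the vertex. -/
theorem hasFDerivAt_coneMap {y : Euc m} (hy : y ≠ 0) :
    HasFDerivAt (coneMap e J c)
      (J.toContinuousLinearMap - (innerSL ℝ ((c * ‖y‖⁻¹) • y)).smulRight e) y := by
  have hy' : ‖y‖ ≠ 0 := norm_ne_zero_iff.2 hy
  have h1 : HasFDerivAt (fun y : Euc m => ‖y‖) (innerSL ℝ (‖y‖⁻¹ • y)) y := by
    have h := (hasStrictFDerivAt_norm_sq y).hasFDerivAt.sqrt (by positivity)
    simp only [Real.sqrt_sq (norm_nonneg _)] at h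
    refine h.congr_fderiv ?_
    ext v
    simp
    field_simp
  have h2 : HasFDerivAt (fun y : Euc m => 1 - c * ‖y‖) (-(c • innerSL ℝ (‖y‖⁻¹ • y))) y :=
    (h1.const_mul c).const_sub 1
  refine ((h2.smul_const e).add J.toContinuousLinearMap.hasFDerivAt).congr_fderiv ?_
  ext1 v
  simp [mul_assoc]
  module

theorem normDet_fderiv_coneMap (he : ‖e‖ = 1) (hJ : IsTangentFrame e J) {y : Euc m}
    (hy : y ≠ 0) :
    (J.toContinuousLinearMap - (innerSL ℝ ((c * ‖y‖⁻¹) • y)).smulRight e).toLinearMap.normDet =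
      √(c ^ 2 + 1) := by
  classical
  have hy' : ‖y‖ ≠ 0 := norm_ne_zero_iff.2 hy
  set L := (J.toContinuousLinearMap - (innerSL ℝ ((c * ‖y‖⁻¹) • y)).smulRight e).toLinearMap
    with hL
  rw [← Real.sqrt_sq L.normDet_nonneg]
  congr 1
  have h := L.normDet_sq_eq_det_gram (EuclideanSpace.basisFun (Fin m) ℝ)
  simp only [RCLike.ofReal_real_eq_id, id] at h
  rw [h]
  set u : Fin m → ℝ := fun i => c * ‖y‖⁻¹ * y i with hu
  have hgram : Matrix.gram ℝ (fun i => L (EuclideanSpace.basisFun (Fin m) ℝ i)) =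
      1 + Matrix.replicateCol Unit u * Matrix.replicateRow Unit u := by
    have hLi : ∀ i, L (EuclideanSpace.basisFun (Fin m) ℝ i) =
        (-u i) • e + J (EuclideanSpace.basisFun (Fin m) ℝ i) := by
      intro i
      simp only [hL, hu, ContinuousLinearMap.toLinearMap_sub, LinearMap.sub_apply,
        ContinuousLinearMap.coe_coe, LinearIsometry.coe_toContinuousLinearMap,
        ContinuousLinearMap.smulRight_apply, innerSL_apply_apply, inner_smul_left,
        EuclideanSpace.basisFun_apply, EuclideanSpace.inner_single_right]
      simp only [conj_trivial, one_mul, neg_smul]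
      abel
    ext i j
    rw [Matrix.gram_apply, hLi, hLi]
    simp only [inner_add_left, inner_add_right, inner_smul_left, inner_smul_right,
      real_inner_self_eq_norm_sq, he, hJ.inner_eq_zero, J.inner_map_map,
      real_inner_comm (J _) e, conj_trivial]
    rw [orthonormal_iff_ite.1 (EuclideanSpace.basisFun (Fin m) ℝ).orthonormal i j]
    simp [Matrix.one_apply, Matrix.mul_apply]
    ring
  rw [hgram, Matrix.det_one_add_replicateCol_mul_replicateRow]
  have hyy : ∑ i, y i * y i = ‖y‖ ^ 2 := by
    rw [EuclideanSpace.real_norm_sq_eq]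
    exact Finset.sum_congr rfl fun i _ => (sq _).symm
  have : u ⬝ᵥ u = c ^ 2 := by
    simp only [dotProduct, hu]
    calc ∑ i, c * ‖y‖⁻¹ * y i * (c * ‖y‖⁻¹ * y i) = (c * ‖y‖⁻¹) ^ 2 * ∑ i, y i * y i := by
          rw [Finset.mul_sum]
          exact Finset.sum_congr rfl fun i _ => by ring
      _ = c ^ 2 := by rw [hyy]; field_simp
  rw [this]
  ring

/-- The graph parametrization multiplies volumes by a constant factor. -/
theorem euclideanHausdorffMeasure_image_coneMap (hm : 0 < m) (he : ‖e‖ = 1)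
    (hJ : IsTangentFrame e J) {s : Set (Euc m)} (hs : MeasurableSet s) :
    Measure.euclideanHausdorffMeasure m (coneMap e J c '' s) =
      ENNReal.ofReal √(c ^ 2 + 1) * volume s := by
  have : Nonempty (Fin m) := ⟨⟨0, hm⟩⟩
  have h := euclideanHausdorffMeasure_image_of_normDet_eq
    (hs.diff (measurableSet_singleton (0 : Euc m)))
    (fun x hx => (hasFDerivAt_coneMap (e := e) (J := J) (c := c) hx.2).hasFDerivWithinAt)
    (injective_coneMap he hJ).injOn (J := √(c ^ 2 + 1)) (by positivity)
    (fun x hx => normDet_fderiv_coneMap he hJ hx.2)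
  rw [finrank_euclideanSpace_fin, measure_sdiff_null (measure_singleton _)] at h
  rw [← h]
  refine le_antisymm ?_ (measure_mono (image_mono sdiff_subset))
  have hsub : coneMap e J c '' s ⊆ coneMap e J c '' (s \ {0}) ∪ {coneMap e J c 0} := by
    rintro _ ⟨y, hy, rfl⟩
    by_cases hy0 : y = 0
    · right; rw [hy0]; rfl
    · left; exact ⟨y, ⟨hy, hy0⟩, rfl⟩
  have hpt : Measure.euclideanHausdorffMeasure m {coneMap e J c 0} = 0 := by
    have := Measure.nullSingletonClass_hausdorff (Euc (m + 1)) (d := m) (by exact_mod_cast hm)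
    rw [Measure.euclideanHausdorffMeasure_def, Measure.smul_apply, measure_singleton, smul_zero]
  calc _ ≤ _ := measure_mono hsub
    _ ≤ _ := measure_union_le _ _
    _ = _ := by rw [hpt, add_zero]

end ConeMap

theorem cone_eq_range_coneMap {m : ℕ} (hm : 0 < m) (z : Sph (m + 1))
    {J : Euc m →ₗᵢ[ℝ] Euc (m + 1)} (hJ : IsTangentFrame (z : Euc (m + 1)) J) {ψ : ℝ}
    (hs : 0 < Real.sin ψ) :
    cone z ψ = range (coneMap (z : Euc (m + 1)) J (Real.cos ψ / Real.sin ψ)) := by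
  have hz : ‖(z : Euc (m + 1))‖ = 1 := mem_sphere_zero_iff_norm.1 z.2
  have hsc := Real.sin_sq_add_cos_sq ψ
  ext x
  constructor
  · rintro ⟨r, η, hr, hη, rfl⟩
    have hη1 : ‖(η : Euc (m + 1))‖ = 1 := mem_sphere_zero_iff_norm.1 η.2
    have horth : ⟪r • (η : Euc (m + 1)) + (r * Real.cos ψ) • (z : Euc (m + 1)),
        (z : Euc (m + 1))⟫ = 0 := by
      rw [inner_add_left, inner_smul_left, inner_smul_left, real_inner_self_eq_norm_sq, hz, ← hη]
      simp
    obtain ⟨y, hy⟩ := (hJ _).1 horth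
    have hny : ‖y‖ = r * Real.sin ψ := by
      rw [← J.norm_map, hy, ← Real.sqrt_sq (norm_nonneg _), norm_add_sq_real, norm_smul, norm_smul,
        inner_smul_left, inner_smul_right, hz, hη1, ← neg_eq_iff_eq_neg.2 hη.symm]
      rw [← Real.sqrt_sq (by positivity : 0 ≤ r * Real.sin ψ)]
      congr 1
      simp only [Real.norm_eq_abs, mul_one, sq_abs, conj_trivial]
      linear_combination (-r ^ 2) * hsc
    refine ⟨y, ?_⟩
    rw [coneMap, hny, hy, div_mul_eq_mul_div, mul_div_assoc, mul_div_cancel_right₀ _ hs.ne']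
    module
  · rintro ⟨y, rfl⟩
    obtain ⟨u, hu, hyu⟩ : ∃ u : Euc m, ‖u‖ = 1 ∧ y = ‖y‖ • u := by
      rcases eq_or_ne y 0 with rfl | hy
      · exact ⟨EuclideanSpace.single ⟨0, hm⟩ 1, by simp, by simp⟩
      · have : ‖y‖ ≠ 0 := norm_ne_zero_iff.2 hy
        exact ⟨‖y‖⁻¹ • y, by simp [norm_smul, this], by rw [smul_smul, mul_inv_cancel₀ this,
          one_smul]⟩
    have hnorm : ‖(-Real.cos ψ) • (z : Euc (m + 1)) + J (Real.sin ψ • u)‖ = 1 := by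
      rw [← Real.sqrt_sq (norm_nonneg _), norm_smul_add_sq hz hJ, norm_smul, hu, Real.norm_eq_abs,
        mul_one, sq_abs, neg_sq, add_comm, hsc, Real.sqrt_one]
    refine ⟨‖y‖ / Real.sin ψ, ⟨_, mem_sphere_zero_iff_norm.2 hnorm⟩, by positivity, ?_, ?_⟩
    · simp only
      rw [inner_add_left, hJ.inner_eq_zero, inner_smul_left, real_inner_self_eq_norm_sq, hz]
      simp
    · have hJy : J y = ‖y‖ • J u := by
        conv_lhs => rw [hyu]
        rw [map_smul]
      have hscal : ‖y‖ / Real.sin ψ * Real.sin ψ = ‖y‖ := div_mul_cancel₀ _ hs.ne'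
      change _ = (z : Euc (m + 1)) + (‖y‖ / Real.sin ψ) •
        ((-Real.cos ψ) • (z : Euc (m + 1)) + J (Real.sin ψ • u))
      rw [coneMap, hJy, map_smul, smul_add, smul_smul, smul_smul, hscal,
        show ‖y‖ / Real.sin ψ * -Real.cos ψ = -(Real.cos ψ / Real.sin ψ * ‖y‖) by ring]
      module

theorem sqrt_cot_sq_add_one {ψ : ℝ} (hs : 0 < Real.sin ψ) :
    √((Real.cos ψ / Real.sin ψ) ^ 2 + 1) = (Real.sin ψ)⁻¹ := by
  rw [← Real.sqrt_sq (inv_pos.2 hs).le]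
  congr 1
  field_simp
  linarith [Real.sin_sq_add_cos_sq ψ]

/-- The surface measure on the cone is a constant multiple of the image of Lebesgue measure under
the graph parametrization. -/
theorem coneMeasure_eq_map {m : ℕ} (hm : 0 < m) (z : Sph (m + 1))
    {J : Euc m →ₗᵢ[ℝ] Euc (m + 1)} (hJ : IsTangentFrame (z : Euc (m + 1)) J) {ψ : ℝ}
    (hs : 0 < Real.sin ψ) :
    coneMeasure z ψ = ENNReal.ofReal (Real.sin ψ)⁻¹ •
      Measure.map (coneMap (z : Euc (m + 1)) J (Real.cos ψ / Real.sin ψ)) volume := by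
  have hz : ‖(z : Euc (m + 1))‖ = 1 := mem_sphere_zero_iff_norm.1 z.2
  set Φ := coneMap (z : Euc (m + 1)) J (Real.cos ψ / Real.sin ψ)
  ext A hA
  have hΦ : Measurable Φ := continuous_coneMap.measurable
  rw [Measure.smul_apply, Measure.map_apply hΦ hA, coneMeasure, Measure.restrict_apply hA,
    cone_eq_range_coneMap hm z hJ hs, ← image_preimage_eq_inter_range, smul_eq_mul,
    ← sqrt_cot_sq_add_one hs]
  exact euclideanHausdorffMeasure_image_coneMap hm hz hJ (hΦ hA)

/-- In dimension at least three, the cone of opening angle `0` is a null set. -/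
theorem coneMeasure_zero {n : ℕ} (hn : 3 ≤ n) (z : Sph n) : coneMeasure z 0 = 0 := by
  rw [coneMeasure, Measure.restrict_eq_zero, Measure.euclideanHausdorffMeasure_def,
    Measure.smul_apply]
  have hz : ‖(z : Euc n)‖ = 1 := mem_sphere_zero_iff_norm.1 z.2
  set ray : ℝ → Euc n := fun r => (z : Euc n) + r • (-(z : Euc n)) with hray
  have hsub : cone z 0 ⊆ ray '' univ := by
    rintro _ ⟨r, η, -, hη, rfl⟩
    refine ⟨r, trivial, ?_⟩
    have hη1 : ‖(η : Euc n)‖ = 1 := mem_sphere_zero_iff_norm.1 η.2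
    rw [Real.cos_zero, ← inner_neg_right] at hη
    rw [(inner_eq_one_iff_of_norm_eq_one hη1 (by rw [norm_neg, hz])).1 hη]
  have hlip : LipschitzWith 1 ray := by
    refine LipschitzWith.of_dist_le_mul fun a b => ?_
    rw [hray, dist_add_left, dist_eq_norm, ← sub_smul, norm_smul, norm_neg, hz, dist_eq_norm]
    simp
  have hdim : dimH (cone z 0) < ((n - 1 : ℕ) : NNReal) := by
    calc dimH (cone z 0) ≤ dimH (ray '' univ) := dimH_mono hsub
      _ ≤ dimH (univ : Set ℝ) := hlip.dimH_image_le _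
      _ = 1 := Real.dimH_univ
      _ < _ := by
        have : 1 < n - 1 := by omega
        exact_mod_cast this
  have := hausdorffMeasure_of_dimH_lt hdim
  rw [NNReal.coe_natCast] at this
  rw [this, smul_zero]

/-! ### The transform in graph coordinates -/

theorem IsTestFunction.continuous {n : ℕ} {f : Euc n → ℝ} (hf : IsTestFunction f) :
    Continuous f := hf.contDiff.continuous

theorem IsTestFunction.eq_zero {n : ℕ} {f : Euc n → ℝ} (hf : IsTestFunction f) {x : Euc n}
    (hx : 1 ≤ ‖x‖) : f x = 0 := by
  by_contra h
  have := hf.tsupport_subset (subset_tsupport f h)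
  rw [mem_ball_zero_iff] at this
  linarith

theorem IsRadialWeight.continuous_comp {U : ℝ → ℝ} (hU : IsRadialWeight U) {X : Type*}
    [TopologicalSpace X] {r : X → ℝ} (hr : Continuous r) (hr0 : ∀ x, 0 ≤ r x) :
    Continuous fun x => U (r x) :=
  hU.contDiffOn.continuousOn.comp_continuous hr hr0

section Graph

variable {m : ℕ} {U : ℝ → ℝ} {f : Euc (m + 1) → ℝ} {ψ : ℝ}

theorem norm_coneMap_sub_eq_div {e : Euc (m + 1)} {J : Euc m →ₗᵢ[ℝ] Euc (m + 1)} (he : ‖e‖ = 1)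
    (hJ : IsTangentFrame e J) (hs : 0 < Real.sin ψ) (y : Euc m) :
    ‖coneMap e J (Real.cos ψ / Real.sin ψ) y - e‖ = ‖y‖ / Real.sin ψ := by
  rw [norm_coneMap_sub he hJ, sqrt_cot_sq_add_one hs, inv_mul_eq_div]

theorem norm_coneMap_eq {e : Euc (m + 1)} {J : Euc m →ₗᵢ[ℝ] Euc (m + 1)} (he : ‖e‖ = 1)
    (hJ : IsTangentFrame e J) (hs : 0 < Real.sin ψ) (y : Euc m) :
    ‖coneMap e J (Real.cos ψ / Real.sin ψ) y‖ =
      √((‖y‖ / Real.sin ψ - Real.cos ψ) ^ 2 + Real.sin ψ ^ 2) := by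
  rw [← Real.sqrt_sq (norm_nonneg (coneMap e J _ y)), norm_coneMap_sq he hJ]
  congr 1
  field_simp
  linear_combination (‖y‖ ^ 2 - Real.sin ψ ^ 2) * Real.sin_sq_add_cos_sq ψ

/-- The graph parametrization is proper: where `f` does not vanish, `‖y‖ < 1`. -/
theorem norm_le_norm_coneMap {e : Euc (m + 1)} {J : Euc m →ₗᵢ[ℝ] Euc (m + 1)} (he : ‖e‖ = 1)
    (hJ : IsTangentFrame e J) (c : ℝ) (y : Euc m) : ‖y‖ ≤ ‖coneMap e J c y‖ := by
  refine abs_le_of_sq_le_sq' ?_ (norm_nonneg _) |>.2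
  rw [norm_coneMap_sq he hJ]
  nlinarith [sq_nonneg (1 - c * ‖y‖)]

theorem integrable_coneMeasure (hm : 0 < m) (hU : IsRadialWeight U) (hf : IsTestFunction f)
    (hs : 0 < Real.sin ψ) (z : Sph (m + 1)) :
    Integrable (fun x => f x * U ‖x - (z : Euc (m + 1))‖) (coneMeasure z ψ) := by
  have hz : ‖(z : Euc (m + 1))‖ = 1 := mem_sphere_zero_iff_norm.1 z.2
  obtain ⟨J, hJ⟩ := exists_isTangentFrame (e := (z : Euc (m + 1))) (by
    rw [← norm_ne_zero_iff, hz]; exact one_ne_zero)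
  rw [coneMeasure_eq_map hm z hJ hs]
  refine Integrable.smul_measure ?_ ENNReal.ofReal_ne_top
  rw [(measurableEmbedding_coneMap hz hJ).integrable_map_iff]
  have hΦ := continuous_coneMap (e := (z : Euc (m + 1))) (J := J)
    (c := Real.cos ψ / Real.sin ψ)
  refine Continuous.integrable_of_hasCompactSupport ?_ ?_
  · exact (hf.continuous.comp hΦ).mul
      (hU.continuous_comp (by fun_prop) fun y => norm_nonneg _)
  · refine HasCompactSupport.intro (isCompact_closedBall 0 1) fun y hy => ?_
    rw [mem_closedBall_zero_iff, not_le] at hy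
    simp only [Function.comp_apply]
    rw [hf.eq_zero (hy.le.trans (norm_le_norm_coneMap hz hJ _ y)), zero_mul]

/-- The transform in graph coordinates that are transported by a rotation. -/
theorem conicalRadon_rotate (hm : 0 < m) (hs : 0 < Real.sin ψ) {p : Sph (m + 1)}
    {J : Euc m →ₗᵢ[ℝ] Euc (m + 1)} (hJ : IsTangentFrame (p : Euc (m + 1)) J)
    (g : OrthGroup (m + 1)) :
    conicalRadon U f (rotate g p) ψ = (Real.sin ψ)⁻¹ *
      ∫ y, f ((g : Euc (m + 1) →L[ℝ] Euc (m + 1))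
        (coneMap (p : Euc (m + 1)) J (Real.cos ψ / Real.sin ψ) y)) * U (‖y‖ / Real.sin ψ) := by
  set L := Unitary.linearIsometryEquiv g with hL
  have hLg : ∀ x, L x = (g : Euc (m + 1) →L[ℝ] Euc (m + 1)) x := fun x => rfl
  have hgz : ‖(rotate g p : Euc (m + 1))‖ = 1 := mem_sphere_zero_iff_norm.1 (rotate g p).2
  have hJg : IsTangentFrame (rotate g p : Euc (m + 1)) (L.toLinearIsometry.comp J) := by
    intro x
    have h1 : ⟪x, (rotate g p : Euc (m + 1))⟫ = ⟪L.symm x, (p : Euc (m + 1))⟫ := by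
      rw [coe_rotate, ← hLg, ← L.inner_map_map (L.symm x), L.apply_symm_apply]
    rw [h1, hJ]
    constructor
    · rintro ⟨y, hy⟩
      exact ⟨y, by simp [hy]⟩
    · rintro ⟨y, rfl⟩
      exact ⟨y, by simp⟩
  have hmap : ∀ c y, coneMap (rotate g p : Euc (m + 1)) (L.toLinearIsometry.comp J) c y =
      (g : Euc (m + 1) →L[ℝ] Euc (m + 1)) (coneMap (p : Euc (m + 1)) J c y) := by
    intro c y
    simp only [coneMap, map_add, map_smul, coe_rotate]
    rfl
  rw [conicalRadon, coneMeasure_eq_map hm _ hJg hs, integral_smul_measure,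
    (measurableEmbedding_coneMap hgz hJg).integral_map, ENNReal.toReal_ofReal (inv_pos.2 hs).le,
    smul_eq_mul]
  congr 1
  refine integral_congr_ae (Filter.Eventually.of_forall fun y => ?_)
  simp only
  rw [norm_coneMap_sub_eq_div hgz hJg hs, hmap]

theorem continuous_conicalRadon (hm : 0 < m) (hU : IsRadialWeight U) (hf : IsTestFunction f)
    (hs : 0 < Real.sin ψ) : Continuous fun z : Sph (m + 1) => conicalRadon U f z ψ := by
  set p := pole m
  have hp : ‖(p : Euc (m + 1))‖ = 1 := mem_sphere_zero_iff_norm.1 p.2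
  obtain ⟨J, hJ⟩ := exists_isTangentFrame (e := (p : Euc (m + 1))) (by
    rw [← norm_ne_zero_iff, hp]; exact one_ne_zero)
  -- The orbit map of the pole is a quotient map.
  have horb : Continuous fun g : OrthGroup (m + 1) => rotate g p :=
    continuous_rotate.comp (Continuous.prodMk_left p)
  have hq : Topology.IsQuotientMap fun g : OrthGroup (m + 1) => rotate g p :=
    horb.isClosedMap.isQuotientMap horb (exists_rotate_eq p)
  rw [hq.continuous_iff]
  have hΦ := continuous_coneMap (e := (p : Euc (m + 1))) (J := J)
    (c := Real.cos ψ / Real.sin ψ)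
  have hK : ∀ g : OrthGroup (m + 1), conicalRadon U f (rotate g p) ψ = (Real.sin ψ)⁻¹ *
      ∫ y in closedBall (0 : Euc m) 1, f ((g : Euc (m + 1) →L[ℝ] Euc (m + 1))
        (coneMap (p : Euc (m + 1)) J (Real.cos ψ / Real.sin ψ) y)) * U (‖y‖ / Real.sin ψ) := by
    intro g
    rw [conicalRadon_rotate hm hs hJ, setIntegral_eq_integral_of_forall_compl_eq_zero]
    intro y hy
    rw [mem_closedBall_zero_iff, not_le] at hy
    rw [hf.eq_zero, zero_mul]
    rw [Unitary.norm_map]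
    exact hy.le.trans (norm_le_norm_coneMap hp hJ _ y)
  refine (continuous_congr hK).2 (continuous_const.mul ?_)
  refine continuous_parametric_integral_of_continuous ?_ (isCompact_closedBall 0 1)
  refine (hf.continuous.comp ?_).mul (hU.continuous_comp (by fun_prop) fun q => by positivity)
  exact (continuous_subtype_val.comp continuous_fst).clm_apply (hΦ.comp continuous_snd)

theorem continuous_radialCoeff {n : ℕ} (Y : C(Sph n, ℝ)) {f : Euc n → ℝ}
    (hf : IsTestFunction f) : Continuous (radialCoeff Y f) := by
  have h : ∀ ρ : ℝ, radialCoeff Y f ρ =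
      ∫ θ in univ, f (ρ • (θ : Euc n)) * Y θ ∂(sphMeasure n) := by
    intro ρ
    rw [Measure.restrict_univ]; rfl
  refine (continuous_congr h).2 ?_
  refine continuous_parametric_integral_of_continuous
    (f := fun (ρ : ℝ) (θ : Sph n) => f (ρ • (θ : Euc n)) * Y θ) ?_ isCompact_univ
  have := hf.continuous
  fun_prop

theorem radialCoeff_eq_zero {n : ℕ} (Y : C(Sph n, ℝ)) {f : Euc n → ℝ} (hf : IsTestFunction f)
    {ρ : ℝ} (hρ : 1 ≤ ρ) : radialCoeff Y f ρ = 0 := by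
  rw [radialCoeff, sphCoeff]
  refine integral_eq_zero_of_ae (Filter.Eventually.of_forall fun θ => ?_)
  have : f (ρ • (θ : Euc n)) = 0 := hf.eq_zero (by
    rw [norm_smul, mem_sphere_zero_iff_norm.1 θ.2, mul_one]
    exact hρ.trans (le_abs_self ρ))
  simp [this]

/-- The weighted contribution of the points at distance `r` from the vertex to the coefficient of
`𝒞f`, up to the area element: these points have norm `ρ = √((r - cos ψ) ^ 2 + sin ψ ^ 2)` and inner
product `1 - r * cos ψ` with the vertex. -/
def coneProfile (m : ℕ) (Y : C(Sph (m + 1), ℝ)) (U : ℝ → ℝ) (f : Euc (m + 1) → ℝ) (ℓ : ℕ)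
    (ψ r : ℝ) : ℝ :=
  U r * ((gegenbauer (((m : ℝ) - 1) / 2) ℓ).eval
      ((1 - Real.cos ψ * r) / √((r - Real.cos ψ) ^ 2 + Real.sin ψ ^ 2)) *
    radialCoeff Y f (√((r - Real.cos ψ) ^ 2 + Real.sin ψ ^ 2)))

/-- By Fubini and the mean value property, the coefficient of `𝒞f` is an integral over the tangent
hyperplane of a function of the norm. -/
theorem conicalCoeff_eq_integral_coneProfile (hm : 0 < m) (hU : IsRadialWeight U)
    (hf : IsTestFunction f) (hs : 0 < Real.sin ψ) {ℓ : ℕ} {Y : C(Sph (m + 1), ℝ)}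
    (hY : Y ∈ sphericalHarmonics (m + 1) ℓ) :
    conicalCoeff Y U f ψ =
      (Real.sin ψ)⁻¹ * ∫ y : Euc m, coneProfile m Y U f ℓ ψ (‖y‖ / Real.sin ψ) := by
  set p := pole m
  have hp : ‖(p : Euc (m + 1))‖ = 1 := mem_sphere_zero_iff_norm.1 p.2
  obtain ⟨J, hJ⟩ := exists_isTangentFrame (e := (p : Euc (m + 1))) (by
    rw [← norm_ne_zero_iff, hp]; exact one_ne_zero)
  set Φ := coneMap (p : Euc (m + 1)) J (Real.cos ψ / Real.sin ψ) with hΦdef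
  have hΦ : Continuous Φ := continuous_coneMap
  have hcont := continuous_conicalRadon (ψ := ψ) hm hU hf hs
  rw [conicalCoeff, sphCoeff, integral_sphMeasure_eq_integral_orthMeasure
    (h := fun z => conicalRadon U f z ψ * Y z) (hcont.mul Y.continuous) p]
  have h1 : ∀ g : OrthGroup (m + 1), conicalRadon U f (rotate g p) ψ * Y (rotate g p) =
      (Real.sin ψ)⁻¹ * ∫ y, U (‖y‖ / Real.sin ψ) *
        (f ((g : Euc (m + 1) →L[ℝ] Euc (m + 1)) (Φ y)) * Y (rotate g p)) := by
    intro g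
    rw [conicalRadon_rotate hm hs hJ, mul_assoc, ← integral_mul_const]
    congr 1
    refine integral_congr_ae (Filter.Eventually.of_forall fun y => ?_)
    simp only
    ring
  have hswap : ∫ g, (∫ y, U (‖y‖ / Real.sin ψ) *
        (f ((g : Euc (m + 1) →L[ℝ] Euc (m + 1)) (Φ y)) * Y (rotate g p))) ∂(orthMeasure (m + 1)) =
      ∫ y, ∫ g, U (‖y‖ / Real.sin ψ) * (f ((g : Euc (m + 1) →L[ℝ] Euc (m + 1)) (Φ y)) *
        Y (rotate g p)) ∂(orthMeasure (m + 1)) := by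
    refine integral_integral_swap_of_hasCompactSupport
      (f := fun (g : OrthGroup (m + 1)) (y : Euc m) => U (‖y‖ / Real.sin ψ) *
        (f ((g : Euc (m + 1) →L[ℝ] Euc (m + 1)) (Φ y)) * Y (rotate g p))) ?_ ?_
    · refine (hU.continuous_comp (by fun_prop) fun q => by positivity).mul
        ((hf.continuous.comp ?_).mul (Y.continuous.comp ?_))
      · exact (continuous_subtype_val.comp continuous_fst).clm_apply (hΦ.comp continuous_snd)
      · exact continuous_rotate.comp (continuous_fst.prodMk continuous_const)
    · refine HasCompactSupport.intro (isCompact_univ.prod (isCompact_closedBall (0 : Euc m) 1))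
        fun q hq => ?_
      have hq2 : 1 < ‖q.2‖ := by
        by_contra h
        exact hq ⟨trivial, mem_closedBall_zero_iff.2 (not_lt.1 h)⟩
      simp only [Function.uncurry]
      rw [hf.eq_zero (x := (q.1 : Euc (m + 1) →L[ℝ] Euc (m + 1)) (Φ q.2)), zero_mul, mul_zero]
      rw [Unitary.norm_map]
      exact hq2.le.trans (norm_le_norm_coneMap hp hJ _ _)
  simp_rw [h1]
  rw [integral_const_mul, hswap, mul_left_comm, ← integral_const_mul]
  congr 1
  refine integral_congr_ae (Filter.Eventually.of_forall fun y => ?_)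
  simp only
  rw [integral_const_mul, mul_left_comm, coneProfile]
  congr 1
  have hρ := norm_coneMap_eq (ψ := ψ) hp hJ hs y
  rw [← hΦdef] at hρ
  set ρ := ‖Φ y‖ with hρdef
  have hρ0 : 0 < ρ := by rw [hρ]; positivity
  -- The point of the sphere in the direction of `Φ y`.
  set θ : Sph (m + 1) := ⟨ρ⁻¹ • Φ y, by
    rw [mem_sphere_zero_iff_norm, norm_smul, norm_inv, Real.norm_eq_abs, abs_of_pos hρ0, ← hρdef,
      inv_mul_cancel₀ hρ0.ne']⟩ with hθ
  have hΦθ : ρ • (θ : Euc (m + 1)) = Φ y := by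
    simp [hθ, smul_smul, mul_inv_cancel₀ hρ0.ne']
  have hmean := integral_orthMeasure_mul_eq hm hY
    ⟨fun x => f (ρ • (x : Euc (m + 1))), hf.continuous.comp (by fun_prop)⟩ p θ
  have hinner : ⟪(p : Euc (m + 1)), (θ : Euc (m + 1))⟫ =
      (1 - Real.cos ψ * (‖y‖ / Real.sin ψ)) / ρ := by
    rw [hθ]
    simp only
    rw [inner_smul_right, inner_coneMap hp hJ, inv_mul_eq_div]
    congr 1
    ring
  rw [hinner] at hmean
  rw [← hρ]
  refine Eq.trans ?_ (hmean.trans ?_)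
  · congr 1
    refine integral_congr_ae (Filter.Eventually.of_forall fun g => ?_)
    simp only [ContinuousMap.coe_mk]
    rw [coe_rotate, ← map_smul, hΦθ]
  · rfl

end Graph

/-! ### Reduction to an Abel-type integral -/

/-- The substitution `ρ ^ 2 = (r - a) ^ 2 + s ^ 2`, which takes the same value `ρ` at the two points
`r = a ± √(ρ ^ 2 - s ^ 2)`. -/
theorem integral_Ioi_eq_abel {G : ℝ → ℝ} {a s : ℝ} (ha : 0 ≤ a) (hs : 0 < s)
    (has : a ^ 2 + s ^ 2 = 1) (hG : ContinuousOn G (Ici 0)) (hG0 : ∀ r, 2 * a ≤ r → G r = 0) :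
    IntegrableOn (fun ρ => ρ / √(ρ ^ 2 - s ^ 2) *
      (G (a - √(ρ ^ 2 - s ^ 2)) + G (a + √(ρ ^ 2 - s ^ 2)))) (Ioo s 1) ∧
    ∫ r in Ioi 0, G r = ∫ ρ in Ioo s 1, ρ / √(ρ ^ 2 - s ^ 2) *
      (G (a - √(ρ ^ 2 - s ^ 2)) + G (a + √(ρ ^ 2 - s ^ 2))) := by
  set q : ℝ → ℝ := fun ρ => √(ρ ^ 2 - s ^ 2) with hq
  set h : ℝ → ℝ := fun t => G (a - t) + G (a + t) with hh
  have hpos : ∀ ρ ∈ Ioo s 1, 0 < ρ ^ 2 - s ^ 2 := fun ρ hρ => by nlinarith [hρ.1]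
  have himg : q '' Ioo s 1 = Ioo 0 a := by
    ext t
    constructor
    · rintro ⟨ρ, hρ, rfl⟩
      refine ⟨Real.sqrt_pos.2 (hpos ρ hρ), (Real.sqrt_lt' ?_).2 ?_⟩
      · rcases ha.lt_or_eq with h | h
        · exact h
        · subst h
          nlinarith [hρ.1, hρ.2]
      · nlinarith [hρ.1, hρ.2]
    · rintro ⟨h0, h1⟩
      refine ⟨√(t ^ 2 + s ^ 2), ⟨?_, ?_⟩, ?_⟩
      · exact Real.lt_sqrt_of_sq_lt (by nlinarith)
      · rw [Real.sqrt_lt' one_pos]; nlinarith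
      · simp only [hq]
        rw [Real.sq_sqrt (by positivity), add_sub_cancel_right, Real.sqrt_sq h0.le]
  have hder : ∀ ρ ∈ Ioo s 1, HasDerivWithinAt q (ρ / √(ρ ^ 2 - s ^ 2)) (Ioo s 1) ρ := by
    intro ρ hρ
    have h1 : HasDerivAt (fun ρ : ℝ => ρ ^ 2 - s ^ 2) (2 * ρ) ρ := by
      simpa using (hasDerivAt_pow 2 ρ).sub_const (s ^ 2)
    refine ((h1.sqrt (hpos ρ hρ).ne').congr_deriv ?_).hasDerivWithinAt
    rw [mul_div_mul_left _ _ two_ne_zero]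
  have hinj : InjOn q (Ioo s 1) := by
    intro ρ hρ ρ' hρ' heq
    have h1 := (Real.sqrt_inj (hpos ρ hρ).le (hpos ρ' hρ').le).1 heq
    have h2 : ρ ^ 2 = ρ' ^ 2 := by linarith
    exact (pow_left_inj₀ (hs.trans hρ.1).le (hs.trans hρ'.1).le two_ne_zero).1 h2
  have habs : ∀ ρ ∈ Ioo s 1, |ρ / √(ρ ^ 2 - s ^ 2)| • h (q ρ) =
      ρ / √(ρ ^ 2 - s ^ 2) * h (q ρ) := by
    intro ρ hρ
    rw [abs_of_nonneg (div_nonneg (hs.trans hρ.1).le (Real.sqrt_nonneg _)), smul_eq_mul]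
  have hc1 : ContinuousOn (fun t => G (a - t)) (Icc 0 a) :=
    hG.comp (by fun_prop) fun t ht => sub_nonneg.2 ht.2
  have hc2 : ContinuousOn (fun t => G (a + t)) (Icc 0 a) :=
    hG.comp (by fun_prop) fun t ht => add_nonneg ha ht.1
  have hi1 : IntervalIntegrable (fun t => G (a - t)) volume 0 a :=
    hc1.intervalIntegrable_of_Icc ha
  have hi2 : IntervalIntegrable (fun t => G (a + t)) volume 0 a :=
    hc2.intervalIntegrable_of_Icc ha
  have hint : IntegrableOn h (Ioo 0 a) :=
    (hc1.add hc2).integrableOn_Icc.mono_set Ioo_subset_Icc_self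
  refine ⟨?_, ?_⟩
  · rw [← himg, integrableOn_image_iff_integrableOn_abs_deriv_smul measurableSet_Ioo hder hinj]
      at hint
    exact hint.congr_fun habs measurableSet_Ioo
  · have hsplit : ∫ t in Ioo 0 a, h t = ∫ r in Ioi 0, G r := by
      have hGi : ∀ b c, 0 ≤ b → b ≤ c → IntervalIntegrable G volume b c := fun b c hb hbc =>
        (hG.mono fun x hx => hb.trans hx.1).intervalIntegrable_of_Icc hbc
      rw [← integral_Ioc_eq_integral_Ioo, ← intervalIntegral.integral_of_le ha]
      simp only [hh]
      rw [intervalIntegral.integral_add hi1 hi2, intervalIntegral.integral_comp_sub_left,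
        intervalIntegral.integral_comp_add_left, sub_self, sub_zero, add_zero,
        intervalIntegral.integral_add_adjacent_intervals (hGi 0 a le_rfl ha)
          (hGi a (a + a) ha (by linarith)), intervalIntegral.integral_of_le (by linarith)]
      refine (setIntegral_eq_of_subset_of_forall_sdiff_eq_zero measurableSet_Ioi
        Ioc_subset_Ioi_self fun r hr => hG0 r ?_).symm
      by_contra hlt
      exact hr.2 ⟨hr.1, by linarith⟩
    rw [← hsplit, ← himg, integral_image_eq_integral_abs_deriv_smul measurableSet_Ioo hder hinj]
    exact setIntegral_congr_fun measurableSet_Ioo habs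

/-- Polar coordinates in the tangent hyperplane. -/
theorem integral_norm_div_eq {m : ℕ} (hm : 0 < m) {s : ℝ} (hs : 0 < s) (F : ℝ → ℝ) :
    s⁻¹ * ∫ y : Euc m, F (‖y‖ / s) = sphArea m * ∫ r in Ioi 0, (s * r) ^ (m - 1) * F r := by
  have : Nonempty (Fin m) := ⟨⟨0, hm⟩⟩
  have h1 := integral_fun_norm_addHaar (volume : Measure (Euc m)) fun t => F (t / s)
  have h2 := integral_comp_mul_left_Ioi' (fun t => t ^ (m - 1) * F (t / s)) 0 hs
  have h3 : ∀ r, F (s * r / s) = F r := fun r => by rw [mul_div_cancel_left₀ _ hs.ne']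
  simp only [h3, mul_zero, smul_eq_mul] at h2
  simp only [finrank_euclideanSpace_fin, nsmul_eq_mul, smul_eq_mul] at h1
  rw [h1, ← h2, sphArea, Measure.toSphere_real_apply_univ, finrank_euclideanSpace_fin]
  field_simp

section Profile

variable {m : ℕ} {U : ℝ → ℝ} {f : Euc (m + 1) → ℝ} {ψ : ℝ}

theorem continuousOn_coneProfile (hU : IsRadialWeight U) (hf : IsTestFunction f)
    (hs : 0 < Real.sin ψ) (ℓ : ℕ) (Y : C(Sph (m + 1), ℝ)) :
    ContinuousOn (coneProfile m Y U f ℓ ψ) (Ici 0) := by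
  have hne : ∀ r, √((r - Real.cos ψ) ^ 2 + Real.sin ψ ^ 2) ≠ 0 := fun r => by positivity
  refine hU.contDiffOn.continuousOn.mul (Continuous.continuousOn ?_)
  refine ((Polynomial.continuous _).comp (Continuous.div (by fun_prop) (by fun_prop) hne)).mul
    ((continuous_radialCoeff Y hf).comp (by fun_prop))

theorem coneProfile_eq_zero (hf : IsTestFunction f) (hc : 0 ≤ Real.cos ψ) (ℓ : ℕ)
    (Y : C(Sph (m + 1), ℝ)) {r : ℝ} (hr : 2 * Real.cos ψ ≤ r) : coneProfile m Y U f ℓ ψ r = 0 := by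
  rw [coneProfile, radialCoeff_eq_zero Y hf, mul_zero, mul_zero]
  rw [Real.one_le_sqrt]
  nlinarith [Real.sin_sq_add_cos_sq ψ]

/-- The profile at the point at distance `ρ` from the origin that belongs to the sign `σ`. -/
theorem coneProfile_eq_kernelTerm (ℓ : ℕ) (Y : C(Sph (m + 1), ℝ)) {ρ σ : ℝ} (hρ0 : 0 ≤ ρ)
    (hρ : Real.sin ψ ^ 2 ≤ ρ ^ 2) (hσ : σ ^ 2 = 1) :
    (Real.sin ψ * (Real.cos ψ - σ * √(ρ ^ 2 - Real.sin ψ ^ 2))) ^ (m - 1) *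
        coneProfile m Y U f ℓ ψ (Real.cos ψ - σ * √(ρ ^ 2 - Real.sin ψ ^ 2)) =
      radialCoeff Y f ρ * (Real.sin ψ ^ (m - 1) * kernelTerm (m + 1) U ℓ ψ ρ σ) := by
  have hroot : √((Real.cos ψ - σ * √(ρ ^ 2 - Real.sin ψ ^ 2) - Real.cos ψ) ^ 2 +
      Real.sin ψ ^ 2) = ρ := by
    rw [sub_sub_cancel_left, neg_sq, mul_pow, hσ, Real.sq_sqrt (by linarith), one_mul,
      sub_add_cancel, Real.sqrt_sq hρ0]
  have hnum : 1 - Real.cos ψ * (Real.cos ψ - σ * √(ρ ^ 2 - Real.sin ψ ^ 2)) =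
      Real.sin ψ ^ 2 + σ * Real.cos ψ * √(ρ ^ 2 - Real.sin ψ ^ 2) := by
    linear_combination -Real.sin_sq_add_cos_sq ψ
  have hμ : (((m + 1 : ℕ) : ℝ) - 2) / 2 = ((m : ℝ) - 1) / 2 := by push_cast; ring
  rw [coneProfile, kernelTerm, hroot, hnum, hμ, show m + 1 - 2 = m - 1 by omega, mul_pow]
  ring

end Profile

theorem kernel_zero {n : ℕ} (hn : 3 ≤ n) (U : ℝ → ℝ) (ℓ : ℕ) (ρ : ℝ) : kernel n U ℓ 0 ρ = 0 := by
  rw [kernel, Real.sin_zero, zero_pow (by omega), zero_mul]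

end ConicalRadon

end

theorem theorem2p3 (n : ℕ) (hn : 2 ≤ n)
    (U : ℝ → ℝ) (hU : ConicalRadon.IsRadialWeight U)
    (Y : ConicalRadon.HarmonicIndex n → C(ConicalRadon.Sph n, ℝ))
    (hY : ConicalRadon.IsHarmonicSystem Y)
    (f : ConicalRadon.Euc n → ℝ) (hf : ConicalRadon.IsTestFunction f)
    (ℓ : ℕ) (k : Fin (ConicalRadon.numHarmonics n ℓ))
    (ψ : ℝ) (hψ : ψ ∈ Set.Icc 0 (Real.pi / 2)) (hnψ : n = 2 → ψ ≠ 0) :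
    -- the quantities on both sides exist
    (∀ z : ConicalRadon.Sph n, MeasureTheory.Integrable
      (fun x => f x * U ‖x - (z : ConicalRadon.Euc n)‖) (ConicalRadon.coneMeasure z ψ)) ∧
    MeasureTheory.MemLp (fun z => ConicalRadon.conicalRadon U f z ψ) 2
      (ConicalRadon.sphMeasure n) ∧
    IntervalIntegrable (fun ρ => ConicalRadon.radialCoeff (Y ⟨ℓ, k⟩) f ρ *
      (ρ * ConicalRadon.kernel n U ℓ ψ ρ / √(ρ ^ 2 - Real.sin ψ ^ 2)))
      MeasureTheory.volume (Real.sin ψ) 1 ∧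
    -- the generalized Abel equation
    ConicalRadon.conicalCoeff (Y ⟨ℓ, k⟩) U f ψ =
      ConicalRadon.sphArea (n - 1) *
        ∫ ρ in (Real.sin ψ)..1, ConicalRadon.radialCoeff (Y ⟨ℓ, k⟩) f ρ *
          (ρ * ConicalRadon.kernel n U ℓ ψ ρ / √(ρ ^ 2 - Real.sin ψ ^ 2)) := by
  rcases eq_or_ne ψ 0 with rfl | hψ0
  · -- The cone degenerates to a ray, and both sides vanish.
    have hn3 : 3 ≤ n := by
      rcases hn.lt_or_eq with h | h
      · exact h
      · exact absurd rfl (hnψ h.symm)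
    have hzero : ∀ z, ConicalRadon.conicalRadon U f z 0 = 0 := fun z => by
      rw [ConicalRadon.conicalRadon, ConicalRadon.coneMeasure_zero hn3, integral_zero_measure]
    refine ⟨fun z => ?_, ?_, ?_, ?_⟩
    · rw [ConicalRadon.coneMeasure_zero hn3]
      exact integrable_zero_measure
    · simp_rw [hzero]
      exact MemLp.zero'
    · simp [ConicalRadon.kernel_zero hn3]
    · simp [ConicalRadon.kernel_zero hn3, ConicalRadon.conicalCoeff, ConicalRadon.sphCoeff, hzero]
  · obtain ⟨m, rfl⟩ : ∃ m, n = m + 1 := ⟨n - 1, by omega⟩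
    have hm : 0 < m := by omega
    have hs : 0 < Real.sin ψ := Real.sin_pos_of_pos_of_lt_pi (hψ.1.lt_of_ne' hψ0)
      (by linarith [hψ.2, Real.pi_pos])
    have hc : 0 ≤ Real.cos ψ := Real.cos_nonneg_of_mem_Icc ⟨by linarith [hψ.1, Real.pi_pos], hψ.2⟩
    have hcont := ConicalRadon.continuous_conicalRadon (U := U) (f := f) hm hU hf hs
    obtain ⟨habel, heq⟩ := ConicalRadon.integral_Ioi_eq_abel
      (G := fun r => (Real.sin ψ * r) ^ (m - 1) *
        ConicalRadon.coneProfile m (Y ⟨ℓ, k⟩) U f ℓ ψ r) hc hs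
      (by linarith [Real.sin_sq_add_cos_sq ψ])
      ((Continuous.continuousOn (by fun_prop)).mul
        (ConicalRadon.continuousOn_coneProfile hU hf hs ℓ _))
      (fun r hr => by rw [ConicalRadon.coneProfile_eq_zero hf hc ℓ _ hr, mul_zero])
    -- The two points at distance `ρ` from the origin give the two summands of the kernel.
    have hkernel : ∀ ρ ∈ Set.Ioo (Real.sin ψ) 1,
        ρ / √(ρ ^ 2 - Real.sin ψ ^ 2) *
          ((Real.sin ψ * (Real.cos ψ - √(ρ ^ 2 - Real.sin ψ ^ 2))) ^ (m - 1) *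
              ConicalRadon.coneProfile m (Y ⟨ℓ, k⟩) U f ℓ ψ
                (Real.cos ψ - √(ρ ^ 2 - Real.sin ψ ^ 2)) +
            (Real.sin ψ * (Real.cos ψ + √(ρ ^ 2 - Real.sin ψ ^ 2))) ^ (m - 1) *
              ConicalRadon.coneProfile m (Y ⟨ℓ, k⟩) U f ℓ ψ
                (Real.cos ψ + √(ρ ^ 2 - Real.sin ψ ^ 2))) =
        ConicalRadon.radialCoeff (Y ⟨ℓ, k⟩) f ρ *
          (ρ * ConicalRadon.kernel (m + 1) U ℓ ψ ρ / √(ρ ^ 2 - Real.sin ψ ^ 2)) := by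
      intro ρ hρ
      have hρ0 : 0 ≤ ρ := (hs.trans hρ.1).le
      have hρs : Real.sin ψ ^ 2 ≤ ρ ^ 2 := pow_le_pow_left₀ hs.le hρ.1.le 2
      have h1 := ConicalRadon.coneProfile_eq_kernelTerm (U := U) (f := f) ℓ (Y ⟨ℓ, k⟩) (σ := 1)
        hρ0 hρs (by norm_num)
      have h2 := ConicalRadon.coneProfile_eq_kernelTerm (U := U) (f := f) ℓ (Y ⟨ℓ, k⟩) (σ := -1)
        hρ0 hρs (by norm_num)
      simp only [one_mul, neg_mul, sub_neg_eq_add] at h1 h2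
      rw [h1, h2, ConicalRadon.kernel, show m + 1 - 2 = m - 1 by omega]
      ring
    refine ⟨ConicalRadon.integrable_coneMeasure hm hU hf hs,
      hcont.memLp_of_hasCompactSupport (HasCompactSupport.of_compactSpace _), ?_, ?_⟩
    · rw [intervalIntegrable_iff_integrableOn_Ioo_of_le (Real.sin_le_one ψ)]
      exact habel.congr_fun hkernel measurableSet_Ioo
    · rw [ConicalRadon.conicalCoeff_eq_integral_coneProfile hm hU hf hs (hY.mem ⟨ℓ, k⟩),
        ConicalRadon.integral_norm_div_eq hm hs, heq,
        intervalIntegral.integral_of_le (Real.sin_le_one ψ), integral_Ioc_eq_integral_Ioo,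
        setIntegral_congr_fun measurableSet_Ioo hkernel]
      rfl
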